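/- Let $\mathbb F$ be a field complete with respect to a non-trivial non-archimedean absolute value $|\cdot|$, and let $t\in\mathbb F$ with $0<|t|<1$. Let $\mathcal H_\infty$ be the unital associative $\mathbb F$-algebra generated by $T_1,T_2,\dots$ with relations $(T_i-1)(T_i+t)=0$, $T_iT_j=T_jT_i$ for $|i-j|>1$, and $T_iT_{i+1}T_i=T_{i+1}T_iT_{i+1}$. Let $\mathfrak S_\infty$ be the group of finitely supported permutations of $\{1,2,\dots\}$, with simple transpositions $s_i=(i\ \,i+1)$; for a reduced expression $\sigma=s_{i_1}\cdots s_{i_r}$ put $T_\sigma=T_{i_1}\cdots T_{i_r}$. Let $\iota$ be the $\mathbb F$-linear anti-automorphism of $\mathcal H_\infty$ with $\iota(T_i)=T_i$ for all $i$. For a partition $\lambda$ let $\lambda^{(\infty)}$ be the diagram obtained by placing an infinite row on top of the Young diagram of $\lambda$, and let $\mathrm{SYT}_\infty(\lambda)$ be the set of bijections $\tau:\lambda^{(\infty)}\to\{1,2,\dots\}$ that increase strictly along rows (left to right) and down columns. The content of the box in row $i$ and column $j$ is $c(i,j)=j-i$, and $c_\tau(k)=c(\tau^{-1}(k))$. Let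 $\tau_\lambda$ be the column-standard tableau (columns filled consecutively from left to right, each from top to bottom), and let $\mathrm{Inv}(\tau)$ be the finite set of pairs of boxes $(\square_1,\square_2)$ with $\tau_\lambda(\square_1)<\tau_\lambda(\square_2)$ and $\tau(\square_1)>\tau(\square_2)$; put $\mathrm{inv}(\tau)=|\mathrm{Inv}(\tau)|$. Let $s_i(\tau)$ be $\tau$ with the labels $i,i+1$ swapped. Let $\hat S_\lambda=c_0(\mathrm{SYT}_\infty(\lambda))$ be the Banach space (supremum norm) of formal sums $\sum_\tau c_\tau e_\tau$, $c_\tau\in\mathbb F$, such that for every $\varepsilon>0$ only finitely many $\tau$ have $|c_\tau|\ge\varepsilon$. The algebra $\mathcal H_\infty$ acts on it by bounded operators determined by the following rules: - $T_ie_\tau=e_\tau$ if $i,i+1$ are in the same row of $\tau$, and $T_ie_\tau=-t\,e_\tau$ if they are in the same column; - if $i+1$ lies strictly to the right of and above $i$ in $\tau$, then, with $d=c_\tau(i+1)-c_\tau(i)$, $T_ie_\tau=e_{s_i(\tau)}+\frac{1-t}{1-t^{d}}e_\tau$; - if $i$ lies strictly to the right of and above $i+1$ in $\tau$, then, with $d=c_\tau(i)-c_\tau(i+1)$,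 $T_ie_\tau=t\frac{(1-t^{d-1})(1-t^{d+1})}{(1-t^d)^2}e_{s_i(\tau)}-t^d\frac{1-t}{1-t^d}e_\tau$. Put $$a(\tau)=t^{\mathrm{inv}(\tau)}\prod_{(\square_1,\square_2)\in\mathrm{Inv}(\tau)}\frac{(1-t^{c(\square_2)-c(\square_1)-1})(1-t^{c(\square_2)-c(\square_1)+1})}{(1-t^{c(\square_2)-c(\square_1)})^2},$$ $$\Big(\sum_\tau\alpha_\tau e_\tau,\sum_\tau\beta_\tau e_\tau\Big)_\lambda=\sum_\tau\alpha_\tau\beta_\tau a(\tau),\qquad \tilde e_\tau=\prod_{(\square_1,\square_2)\in\mathrm{Inv}(\tau)}\frac{1-t^{c(\square_2)-c(\square_1)}}{1-t^{c(\square_2)-c(\square_1)+1}}\;e_\tau .$$ **Proposition.** For every partition $\lambda$ and every $X\in\mathcal H_\infty$ the series $$\Gamma_\lambda(X)=\sum_{\tau\in\mathrm{SYT}_\infty(\lambda)}(X(\tilde e_\tau),\tilde e_\tau)_\lambda$$ converges in $\mathbb F$, and the regularized trace $\Gamma_\lambda:\mathcal H_\infty\to\mathbb F$ so defined satisfies $\Gamma_\lambda\circ\iota=\Gamma_\lambda$.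 In particular, $\Gamma_\lambda(T_\sigma)=\Gamma_\lambda(T_{\sigma^{-1}})$ for all $\sigma\in\mathfrak S_\infty$, whichever reduced expressions of $\sigma$ and $\sigma^{-1}$ are used. -/

import Mathlib

open Filter Topology
open scoped ZeroAtInfty

noncomputable section

namespace HeckeTrace

/-! Indices start at `0`: labels are `0, 1, 2, …` instead of `1, 2, 3, …`, boxes are `(row, column)`
with rows and columns counted from `0`, and the generator `i` is the usual `T_{i+1}`. -/

/-- `t` is a pseudo-uniformizer: `0 < |t| < 1`. -/
def IsPseudoUniformizer {F : Type*} [NontriviallyNormedField F] (t : F) : Prop :=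
  0 < ‖t‖ ∧ ‖t‖ < 1

/-! ### Tableaux of infinite shape -/

/-- The boxes of `λ^(∞)`: an infinite row (row `0`) on top of the Young diagram `λ`. -/
@[ext]
structure InfBox (lam : YoungDiagram) where
  /-- The row of the box, counted from the top. -/
  row : ℕ
  /-- The column of the box. -/
  col : ℕ
  mem : row = 0 ∨ (row - 1, col) ∈ lam

namespace InfBox

variable {lam : YoungDiagram}

/-- The content of a box: column minus row. -/
def content (b : InfBox lam) : ℤ := (b.col : ℤ) - (b.row : ℤ)

/-- The diagram is closed under moving up and to the left. -/
theorem exists_of_le (b : InfBox lam) {r c : ℕ} (hr : r ≤ b.row) (hc : c ≤ b.col) :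
    ∃ a : InfBox lam, a.row = r ∧ a.col = c := by
  refine ⟨⟨r, c, ?_⟩, rfl, rfl⟩
  rcases b.mem with h | h
  · left
    omega
  · right
    exact lam.up_left_mem (Nat.sub_le_sub_right hr 1) hc h

end InfBox

/-- A bijective filling is standard if it increases strictly along rows and down columns. -/
def IsStandard {lam : YoungDiagram} (τ : InfBox lam ≃ ℕ) : Prop :=
  (∀ a b : InfBox lam, a.row = b.row → a.col < b.col → τ a < τ b) ∧
  (∀ a b : InfBox lam, a.col = b.col → a.row < b.row → τ a < τ b)

/-- `SYT_∞(λ)`: the standard bijective fillings of `λ^(∞)`. -/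
@[ext]
structure SYTInf (lam : YoungDiagram) where
  /-- The filling, a bijection from the boxes onto the labels. -/
  filling : InfBox lam ≃ ℕ
  standard : IsStandard filling

instance (lam : YoungDiagram) : TopologicalSpace (SYTInf lam) := ⊥

instance (lam : YoungDiagram) : DiscreteTopology (SYTInf lam) := ⟨rfl⟩

/-- The box of a filling which carries the label `i`. -/
def boxOf {lam : YoungDiagram} (τ : InfBox lam ≃ ℕ) (i : ℕ) : InfBox lam := τ.symm i

/-- The content difference `c_τ(i+1) - c_τ(i)`. -/
def contentDiff {lam : YoungDiagram} (τ : InfBox lam ≃ ℕ) (i : ℕ) : ℤ :=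
  (boxOf τ (i + 1)).content - (boxOf τ i).content

/-- The filling obtained by swapping the labels `i` and `i+1`. -/
def swapLabels {lam : YoungDiagram} (i : ℕ) (τ : InfBox lam ≃ ℕ) : InfBox lam ≃ ℕ :=
  τ.trans (Equiv.swap i (i + 1))

open Classical in
/-- `s_i(τ)`, if swapping the labels `i` and `i+1` results in a standard tableau; otherwise `τ`. -/
def swapTab {lam : YoungDiagram} (i : ℕ) (τ : SYTInf lam) : SYTInf lam :=
  if h : IsStandard (swapLabels i τ.filling) then ⟨swapLabels i τ.filling, h⟩ else τ

section combinatorics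

variable {lam : YoungDiagram}

theorem IsStandard.lt_of_le {τ : InfBox lam ≃ ℕ} (hτ : IsStandard τ) {a b : InfBox lam}
    (hr : a.row ≤ b.row) (hc : a.col ≤ b.col) (hne : a.row < b.row ∨ a.col < b.col) :
    τ a < τ b := by
  obtain ⟨m, hmr, hmc⟩ := b.exists_of_le hr (le_refl b.col)
  rcases hr.lt_or_eq with h | h
  · have h2 : τ m < τ b := hτ.2 m b hmc (by omega)
    rcases hc.lt_or_eq with h' | h'
    · exact (hτ.1 a m hmr.symm (by omega)).trans h2
    · exact hτ.2 a b h' h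
  · exact hτ.1 a b h (by omega)

/-- The four possible relative positions of the labels `i` and `i+1` in a standard tableau. -/
theorem IsStandard.position {τ : InfBox lam ≃ ℕ} (hτ : IsStandard τ) (i : ℕ) :
    ((boxOf τ i).row = (boxOf τ (i + 1)).row ∧ (boxOf τ (i + 1)).col = (boxOf τ i).col + 1) ∨
    ((boxOf τ i).col = (boxOf τ (i + 1)).col ∧ (boxOf τ (i + 1)).row = (boxOf τ i).row + 1) ∨
    ((boxOf τ (i + 1)).row < (boxOf τ i).row ∧ (boxOf τ i).col < (boxOf τ (i + 1)).col) ∨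
    ((boxOf τ i).row < (boxOf τ (i + 1)).row ∧ (boxOf τ (i + 1)).col < (boxOf τ i).col) := by
  set P := boxOf τ i with hP
  set Q := boxOf τ (i + 1) with hQ
  have hp : τ P = i := τ.apply_symm_apply i
  have hq : τ Q = i + 1 := τ.apply_symm_apply (i + 1)
  have hne : P.row ≠ Q.row ∨ P.col ≠ Q.col := by
    by_contra h
    push Not at h
    have := congrArg τ (InfBox.ext h.1 h.2)
    omega
  have key : ∀ r c, P.row ≤ r → r ≤ Q.row → P.col ≤ c → c ≤ Q.col →
      (P.row < r ∨ P.col < c) → (r < Q.row ∨ c < Q.col) → False := by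
    intro r c h1 h2 h3 h4 h5 h6
    obtain ⟨m, hmr, hmc⟩ := Q.exists_of_le h2 h4
    have := hτ.lt_of_le (a := P) (b := m) (by omega) (by omega) (by omega)
    have := hτ.lt_of_le (a := m) (b := Q) (by omega) (by omega) (by omega)
    omega
  have key2 : ¬ (Q.row ≤ P.row ∧ Q.col ≤ P.col) := by
    rintro ⟨h1, h2⟩
    have := hτ.lt_of_le (a := Q) (b := P) h1 h2 (by omega)
    omega
  by_cases h : P.row ≤ Q.row ∧ P.col ≤ Q.col
  · rcases h.1.lt_or_eq with h1 | h1
    · rcases h.2.lt_or_eq with h2 | h2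
      · exact (key P.row Q.col (by omega) (by omega) (by omega) (by omega)
          (by omega) (by omega)).elim
      · by_cases h3 : Q.row = P.row + 1
        · exact Or.inr (Or.inl ⟨h2, h3⟩)
        · exact (key (P.row + 1) P.col (by omega) (by omega) (by omega) (by omega)
            (by omega) (by omega)).elim
    · by_cases h3 : Q.col = P.col + 1
      · exact Or.inl ⟨h1, h3⟩
      · exact (key P.row (P.col + 1) (by omega) (by omega) (by omega) (by omega)
          (by omega) (by omega)).elim
  · omega

theorem IsStandard.contentDiff_ne_zero {τ : InfBox lam ≃ ℕ} (hτ : IsStandard τ) (i : ℕ) :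
    contentDiff τ i ≠ 0 := by
  have := hτ.position i
  unfold contentDiff InfBox.content
  omega

/-- Labels at distance two also have distinct contents. -/
theorem IsStandard.contentDiff_add_ne_zero {τ : InfBox lam ≃ ℕ} (hτ : IsStandard τ) (i : ℕ) :
    contentDiff τ i + contentDiff τ (i + 1) ≠ 0 := by
  intro h0
  set P := boxOf τ i with hP
  set Q := boxOf τ (i + 1 + 1) with hQ
  have hp : τ P = i := τ.apply_symm_apply i
  have hq : τ Q = i + 1 + 1 := τ.apply_symm_apply (i + 1 + 1)
  have h0' : (P.col : ℤ) - P.row = (Q.col : ℤ) - Q.row := by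
    unfold contentDiff InfBox.content at h0
    rw [← hP, ← hQ] at h0
    omega
  have hne : P.row ≠ Q.row ∨ P.col ≠ Q.col := by
    by_contra h
    push Not at h
    have := congrArg τ (InfBox.ext h.1 h.2)
    omega
  rcases lt_or_ge P.row Q.row with h | h
  · obtain ⟨m, hmr, hmc⟩ := Q.exists_of_le (r := P.row) (c := Q.col) (by omega) (by omega)
    obtain ⟨n, hnr, hnc⟩ := Q.exists_of_le (r := Q.row) (c := P.col) (by omega) (by omega)
    have h1 := hτ.lt_of_le (a := P) (b := m) (by omega) (by omega) (by omega)
    have h2 := hτ.lt_of_le (a := m) (b := Q) (by omega) (by omega) (by omega)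
    have h3 := hτ.lt_of_le (a := P) (b := n) (by omega) (by omega) (by omega)
    have h4 := hτ.lt_of_le (a := n) (b := Q) (by omega) (by omega) (by omega)
    have h5 : m = n := τ.injective (by omega)
    have := congrArg InfBox.row h5
    omega
  · have := hτ.lt_of_le (a := Q) (b := P) (by omega) (by omega) (by omega)
    omega

theorem boxOf_swapLabels (i j : ℕ) (τ : InfBox lam ≃ ℕ) :
    boxOf (swapLabels i τ) j = boxOf τ (Equiv.swap i (i + 1) j) := rfl

theorem contentDiff_swapLabels (i : ℕ) (τ : InfBox lam ≃ ℕ) :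
    contentDiff (swapLabels i τ) i = - contentDiff τ i := by
  simp [contentDiff, boxOf_swapLabels]

theorem swapLabels_swapLabels (i : ℕ) (τ : InfBox lam ≃ ℕ) :
    swapLabels i (swapLabels i τ) = τ := by
  ext b
  simp [swapLabels]

theorem IsStandard.swap {τ : InfBox lam ≃ ℕ} (hτ : IsStandard τ) {i : ℕ}
    (h : 2 ≤ contentDiff τ i ∨ contentDiff τ i ≤ -2) : IsStandard (swapLabels i τ) := by
  have key : ∀ a b : InfBox lam, τ a < τ b → ¬ (τ a = i ∧ τ b = i + 1) →
      swapLabels i τ a < swapLabels i τ b := by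
    intro a b hab hn
    simp only [swapLabels, Equiv.trans_apply, Equiv.swap_apply_def]
    split_ifs <;> omega
  have box : ∀ a b : InfBox lam, τ a = i → τ b = i + 1 →
      a.row ≠ b.row ∧ a.col ≠ b.col := by
    intro a b ha hb
    have ha' : boxOf τ i = a := by rw [boxOf, ← ha, τ.symm_apply_apply]
    have hb' : boxOf τ (i + 1) = b := by rw [boxOf, ← hb, τ.symm_apply_apply]
    have hpos := hτ.position i
    unfold contentDiff InfBox.content at h
    rw [ha', hb'] at h hpos
    omega
  exact ⟨fun a b hr hc => key a b (hτ.1 a b hr hc) fun h' => (box a b h'.1 h'.2).1 hr,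
    fun a b hc hr => key a b (hτ.2 a b hc hr) fun h' => (box a b h'.1 h'.2).2 hc⟩

theorem swapTab_coe {τ : SYTInf lam} {i : ℕ}
    (h : 2 ≤ contentDiff τ.filling i ∨ contentDiff τ.filling i ≤ -2) :
    (swapTab i τ).filling = swapLabels i τ.filling := by
  unfold swapTab
  rw [dif_pos (τ.standard.swap h)]

theorem swapTab_swapTab (i : ℕ) (τ : SYTInf lam) : swapTab i (swapTab i τ) = τ := by
  by_cases h : IsStandard (swapLabels i τ.filling)
  · have h1 : swapTab i τ = ⟨swapLabels i τ.filling, h⟩ := dif_pos h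
    rw [h1]
    unfold swapTab
    have h2 : IsStandard (swapLabels i (swapLabels i τ.filling)) := by
      rw [swapLabels_swapLabels]
      exact τ.standard
    rw [dif_pos h2]
    exact SYTInf.ext (swapLabels_swapLabels i τ.filling)
  · have h1 : swapTab i τ = τ := dif_neg h
    rw [h1, h1]

end combinatorics

/-! ### The column-standard tableau and inversions -/

/-- The number of boxes of `λ^(∞)` in the columns to the left of column `c`. -/
def boxesLeft (lam : YoungDiagram) (c : ℕ) : ℕ :=
  ∑ k ∈ Finset.range c, (lam.colLen k + 1)

theorem boxesLeft_succ (lam : YoungDiagram) (c : ℕ) :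
    boxesLeft lam (c + 1) = boxesLeft lam c + (lam.colLen c + 1) :=
  Finset.sum_range_succ _ _

theorem boxesLeft_mono (lam : YoungDiagram) : StrictMono (boxesLeft lam) :=
  strictMono_nat_of_lt_succ fun c => by rw [boxesLeft_succ]; omega

theorem InfBox.row_le {lam : YoungDiagram} (b : InfBox lam) : b.row ≤ lam.colLen b.col := by
  rcases b.mem with h | h
  · omega
  · have : b.row - 1 < lam.colLen b.col := YoungDiagram.mem_iff_lt_colLen.1 h
    omega

/-- Column reading: fill the columns from left to right, each from top to bottom. -/
def colReading (lam : YoungDiagram) (b : InfBox lam) : ℕ := boxesLeft lam b.col + b.row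

theorem colReading_lt {lam : YoungDiagram} {a b : InfBox lam} (h : a.col < b.col) :
    colReading lam a < colReading lam b := by
  have h1 := a.row_le
  have h2 := boxesLeft_succ lam a.col
  have h3 := (boxesLeft_mono lam).monotone (Nat.succ_le_of_lt h)
  simp only [Nat.succ_eq_add_one] at h3
  unfold colReading
  omega

theorem colReading_bijective (lam : YoungDiagram) : Function.Bijective (colReading lam) := by
  constructor
  · intro a b hab
    rcases lt_trichotomy a.col b.col with h | h | h
    · have := colReading_lt h
      omega
    · refine InfBox.ext ?_ h
      unfold colReading at hab
      rw [h] at hab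
      omega
    · have := colReading_lt h
      omega
  · intro n
    have hex : ∃ c, n < boxesLeft lam (c + 1) :=
      ⟨n, lt_of_lt_of_le (Nat.lt_succ_self n) ((boxesLeft_mono lam).id_le (n + 1))⟩
    classical
    set c := Nat.find hex with hc
    have h1 : n < boxesLeft lam (c + 1) := Nat.find_spec hex
    have h0 : boxesLeft lam c ≤ n := by
      rcases Nat.eq_zero_or_pos c with h | h
      · rw [h]
        simp [boxesLeft]
      · have := Nat.find_min hex (m := c - 1) (by omega)
        rw [Nat.sub_add_cancel h] at this
        omega
    rw [boxesLeft_succ] at h1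
    refine ⟨⟨n - boxesLeft lam c, c, ?_⟩, ?_⟩
    · by_cases h : n - boxesLeft lam c = 0
      · exact Or.inl h
      · refine Or.inr (YoungDiagram.mem_iff_lt_colLen.2 ?_)
        show n - boxesLeft lam c - 1 < lam.colLen c
        omega
    · show boxesLeft lam c + (n - boxesLeft lam c) = n
      omega

/-- The column-standard tableau `τ_λ` of shape `λ^(∞)`. -/
def colStd (lam : YoungDiagram) : SYTInf lam :=
  ⟨Equiv.ofBijective (colReading lam) (colReading_bijective lam),
    fun _ _ _ hc => colReading_lt hc,
    fun a b hc hr => by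
      show boxesLeft lam a.col + a.row < boxesLeft lam b.col + b.row
      rw [hc]
      omega⟩

/-- The inversion pairs of `τ`: pairs of boxes `(□₁, □₂)` with `τ_λ(□₁) < τ_λ(□₂)` and
`τ(□₁) > τ(□₂)`. -/
def invSet {lam : YoungDiagram} (τ : SYTInf lam) : Set (InfBox lam × InfBox lam) :=
  {p | (colStd lam).filling p.1 < (colStd lam).filling p.2 ∧ τ.filling p.2 < τ.filling p.1}

theorem invSet_position {lam : YoungDiagram} {τ : SYTInf lam} {p : InfBox lam × InfBox lam}
    (hp : p ∈ invSet τ) : p.2.row < p.1.row ∧ p.1.col < p.2.col := by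
  obtain ⟨h1, h2⟩ := hp
  by_contra hcon
  rcases lt_trichotomy p.1.col p.2.col with h | h | h
  · have := τ.standard.lt_of_le (a := p.1) (b := p.2) (by omega) (by omega) (by omega)
    omega
  · rcases lt_trichotomy p.1.row p.2.row with h' | h' | h'
    · have := τ.standard.2 _ _ h h'
      omega
    · rw [InfBox.ext h' h] at h1
      exact lt_irrefl _ h1
    · have := (colStd lam).standard.2 _ _ h.symm h'
      omega
  · have : (colStd lam).filling p.2 < (colStd lam).filling p.1 := colReading_lt h
    omega

theorem invSet_content {lam : YoungDiagram} {τ : SYTInf lam} {p : InfBox lam × InfBox lam}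
    (hp : p ∈ invSet τ) : 2 ≤ p.2.content - p.1.content := by
  have := invSet_position hp
  unfold InfBox.content
  omega

theorem finite_lower_boxes (lam : YoungDiagram) : {b : InfBox lam | 0 < b.row}.Finite := by
  refine Set.Finite.of_finite_image (f := fun b => (b.row - 1, b.col)) ?_ ?_
  · refine lam.cells.finite_toSet.subset ?_
    rintro _ ⟨b, hb, rfl⟩
    rcases b.mem with h | h
    · exact absurd h (Nat.pos_iff_ne_zero.1 hb)
    · exact h
  · intro a ha b hb hab
    simp only [Prod.mk.injEq] at hab
    simp only [Set.mem_ofPred_eq] at ha hb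
    exact InfBox.ext (by omega) hab.2

theorem invSet_finite {lam : YoungDiagram} (τ : SYTInf lam) : (invSet τ).Finite := by
  refine ((finite_lower_boxes lam).biUnion (t := fun a => (fun b => (a, b)) ''
    (τ.filling ⁻¹' Set.Iio (τ.filling a))) fun a _ => ?_).subset ?_
  · exact ((Set.finite_Iio _).preimage τ.filling.injective.injOn).image _
  · intro p hp
    have h1 := invSet_position hp
    simp only [Set.mem_iUnion, Set.mem_image, Set.mem_ofPred_eq]
    exact ⟨p.1, by omega, p.2, hp.2, rfl⟩

/-- The finite set `Inv(τ)` of inversion pairs. -/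
def Inv {lam : YoungDiagram} (τ : SYTInf lam) : Finset (InfBox lam × InfBox lam) :=
  (invSet_finite τ).toFinset


/-! ### The coefficients of the seminormal form -/

section coefficients

variable {F : Type*} [NontriviallyNormedField F]

/-- The coefficient of `e_τ` in `T_i(e_τ)`, as a function of `x = c_τ(i+1) - c_τ(i)`. For `x = 1`
(same row) it is `1`, for `x = -1` (same column) it is `-t`, and for `x = -d < 0` it is
`-t^d (1-t)/(1-t^d)`. -/
def diagCoeff (t : F) (x : ℤ) : F := (1 - t) / (1 - t ^ x)

/-- The coefficient of `e_{s_i(τ)}` in `T_i(e_τ)`, as a function of `x = c_τ(i+1) - c_τ(i)`: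
`x ≥ 2` means `s_i(τ) > τ`, `x ≤ -2` means `s_i(τ) < τ`, and otherwise `i, i+1` are in the same row
or in the same column. -/
def offCoeff (t : F) (x : ℤ) : F :=
  if 2 ≤ x then 1
  else if x ≤ -2 then t * ((1 - t ^ (-x - 1)) * (1 - t ^ (-x + 1))) / (1 - t ^ (-x)) ^ 2
  else 0

variable {t : F}

theorem IsPseudoUniformizer.ne_zero (ht : IsPseudoUniformizer t) : t ≠ 0 := norm_pos_iff.1 ht.1

theorem norm_zpow_lt_one (ht : IsPseudoUniformizer t) {k : ℤ} (hk : 1 ≤ k) : ‖t ^ k‖ < 1 := by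
  lift k to ℕ using by omega
  rw [zpow_natCast, norm_pow]
  exact pow_lt_one₀ (norm_nonneg _) ht.2 (by omega)

theorem one_sub_zpow_ne_zero (ht : IsPseudoUniformizer t) {k : ℤ} (hk : k ≠ 0) :
    1 - t ^ k ≠ 0 := by
  intro h
  have h1 : t ^ k = 1 := (sub_eq_zero.1 h).symm
  rcases lt_or_gt_of_ne hk with h2 | h2
  · have h3 := norm_zpow_lt_one ht (k := -k) (by omega)
    rw [zpow_neg, h1] at h3
    simp at h3
  · have h3 := norm_zpow_lt_one ht (k := k) (by omega)
    rw [h1] at h3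
    simp at h3

theorem diagCoeff_add (ht : IsPseudoUniformizer t) {x : ℤ} (hx : x ≠ 0) :
    diagCoeff t x + diagCoeff t (-x) = 1 - t := by
  have h1 := one_sub_zpow_ne_zero ht hx
  have h2 := one_sub_zpow_ne_zero ht (neg_ne_zero.2 hx)
  have h0 : t ^ x ≠ 0 := zpow_ne_zero _ ht.ne_zero
  unfold diagCoeff
  rw [zpow_neg] at h2 ⊢
  generalize t ^ x = u at *
  have h3 : u - 1 ≠ 0 := fun h => h1 (by linear_combination -h)
  have h4 : 1 - u⁻¹ = (u - 1) / u := by field_simp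
  rw [h4]
  field_simp
  ring

theorem diagCoeff_triple (ht : IsPseudoUniformizer t) {x y : ℤ} (hx : x ≠ 0) (hy : y ≠ 0)
    (hxy : x + y ≠ 0) :
    diagCoeff t x * diagCoeff t y + diagCoeff t (x + y) * diagCoeff t (-x) =
      diagCoeff t y * diagCoeff t (x + y) := by
  have h1 := one_sub_zpow_ne_zero ht hx
  have h2 := one_sub_zpow_ne_zero ht hy
  have h3 := one_sub_zpow_ne_zero ht hxy
  have h0 : t ^ x ≠ 0 := zpow_ne_zero _ ht.ne_zero
  unfold diagCoeff
  rw [zpow_add₀ ht.ne_zero] at h3 ⊢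
  rw [zpow_neg]
  generalize t ^ x = u at *
  generalize t ^ y = v at *
  have h3' : u - 1 ≠ 0 := fun h => h1 (by linear_combination -h)
  have h4 : 1 - u⁻¹ = (u - 1) / u := by field_simp
  rw [h4]
  field_simp
  ring

theorem offCoeff_mul_pos (ht : IsPseudoUniformizer t) {x : ℤ} (hx : 1 ≤ x) :
    offCoeff t x * offCoeff t (-x) = t + (1 - t) * diagCoeff t x - diagCoeff t x ^ 2 := by
  have h1 := one_sub_zpow_ne_zero ht (k := x) (by omega)
  have h0 := ht.ne_zero
  rcases hx.lt_or_eq with h | h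
  · unfold offCoeff
    rw [if_pos (by omega), if_neg (by omega), if_pos (by omega), neg_neg]
    unfold diagCoeff
    rw [zpow_sub₀ h0, zpow_add₀ h0, zpow_one]
    generalize t ^ x = u at *
    field_simp
    ring
  · subst h
    have h2 : 1 - t ≠ 0 := by simpa using h1
    have h3 : diagCoeff t 1 = 1 := by
      unfold diagCoeff
      rw [zpow_one, div_self h2]
    rw [h3]
    unfold offCoeff
    norm_num

theorem offCoeff_mul (ht : IsPseudoUniformizer t) {x : ℤ} (hx : x ≠ 0) :
    offCoeff t x * offCoeff t (-x) = t + (1 - t) * diagCoeff t x - diagCoeff t x ^ 2 := by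
  rcases lt_or_gt_of_ne hx with h | h
  · have h1 := offCoeff_mul_pos ht (x := -x) (by omega)
    rw [neg_neg, mul_comm] at h1
    rw [h1]
    have h2 := diagCoeff_add ht hx
    have h3 : diagCoeff t (-x) = 1 - t - diagCoeff t x := by linear_combination h2
    rw [h3]
    ring
  · exact offCoeff_mul_pos ht h

theorem norm_one_sub_zpow [IsUltrametricDist F] (ht : IsPseudoUniformizer t) {k : ℤ}
    (hk : 1 ≤ k) : ‖1 - t ^ k‖ = 1 := by
  have h := norm_zpow_lt_one ht hk
  have h1 : ‖-(t ^ k)‖ < 1 := by rwa [norm_neg]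
  rw [sub_eq_add_neg, IsUltrametricDist.norm_add_eq_max_of_norm_ne_norm]
  · rw [norm_one, max_eq_left h1.le]
  · rw [norm_one]
    exact h1.ne'

theorem norm_one_sub_eq_one [IsUltrametricDist F] (ht : IsPseudoUniformizer t) : ‖1 - t‖ = 1 := by
  simpa using norm_one_sub_zpow ht (k := 1) le_rfl

theorem norm_diagCoeff_le [IsUltrametricDist F] (ht : IsPseudoUniformizer t) (x : ℤ) :
    ‖diagCoeff t x‖ ≤ 1 := by
  rcases lt_trichotomy x 0 with h | h | h
  · have h1 : diagCoeff t x = -(t ^ (-x)) * diagCoeff t (-x) := by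
      have h2 := one_sub_zpow_ne_zero ht h.ne
      have h0 : t ^ x ≠ 0 := zpow_ne_zero _ ht.ne_zero
      unfold diagCoeff
      rw [zpow_neg]
      generalize t ^ x = u at *
      have h3 : u - 1 ≠ 0 := fun h => h2 (by linear_combination -h)
      have h4 : 1 - u⁻¹ = (u - 1) / u := by field_simp
      rw [h4]
      field_simp
      ring
    rw [h1, norm_mul, norm_neg]
    have h5 : ‖diagCoeff t (-x)‖ = 1 := by
      unfold diagCoeff
      rw [norm_div, norm_one_sub_eq_one ht, norm_one_sub_zpow ht (by omega), div_one]
    rw [h5, mul_one]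
    exact (norm_zpow_lt_one ht (by omega)).le
  · simp [diagCoeff, h]
  · unfold diagCoeff
    rw [norm_div, norm_one_sub_eq_one ht, norm_one_sub_zpow ht (by omega), div_one]

theorem norm_offCoeff_le [IsUltrametricDist F] (ht : IsPseudoUniformizer t) (x : ℤ) :
    ‖offCoeff t x‖ ≤ 1 := by
  unfold offCoeff
  split_ifs with h1 h2
  · simp
  · rw [norm_div, norm_mul, norm_mul, norm_pow, norm_one_sub_zpow ht (by omega),
      norm_one_sub_zpow ht (by omega), norm_one_sub_zpow ht (by omega)]
    simpa using ht.2.le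
  · simp

end coefficients

/-! ### The Banach space `Ŝ_λ` and the operators `T_i` -/

section operators

variable {F : Type*} [NontriviallyNormedField F] {lam : YoungDiagram}

variable (F lam) in
/-- `Ŝ_λ = c₀(SYT_∞(λ))` with the supremum norm; the set `SYT_∞(λ)` is discrete, so that vanishing
at infinity means that `|c_τ| ≥ ε` for only finitely many `τ`, for all `ε > 0`. -/
abbrev SHat : Type _ := C₀(SYTInf lam, F)

/-- The coefficients of `T_i(∑ c_τ e_τ)`: the coefficient of `e_τ` collects the contribution
of `c_τ T_i(e_τ)` and that of `c_{s_i(τ)} T_i(e_{s_i(τ)})`. -/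
def genFun (t : F) (i : ℕ) (c : SYTInf lam → F) (τ : SYTInf lam) : F :=
  diagCoeff t (contentDiff τ.filling i) * c τ +
    offCoeff t (contentDiff (swapTab i τ).filling i) * c (swapTab i τ)

theorem norm_genFun_le [IsUltrametricDist F] {t : F} (ht : IsPseudoUniformizer t) (i : ℕ)
    (c : SYTInf lam → F) (τ : SYTInf lam) :
    ‖genFun t i c τ‖ ≤ max ‖c τ‖ ‖c (swapTab i τ)‖ := by
  refine (IsUltrametricDist.norm_add_le_max _ _).trans (max_le_max ?_ ?_)
  · rw [norm_mul]
    exact mul_le_of_le_one_left (norm_nonneg _) (norm_diagCoeff_le ht _)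
  · rw [norm_mul]
    exact mul_le_of_le_one_left (norm_nonneg _) (norm_offCoeff_le ht _)

theorem tendsto_cofinite (v : SHat F lam) : Tendsto v cofinite (𝓝 0) := by
  rw [← cocompact_eq_cofinite]
  exact v.zero_at_infty'

theorem norm_apply_le (v : SHat F lam) (τ : SYTInf lam) : ‖v τ‖ ≤ ‖v‖ := by
  rw [← ZeroAtInftyContinuousMap.norm_toBCF_eq_norm]
  exact v.toBCF.norm_coe_le_norm τ

/-- An element of `c₀` from a function tending to `0` along the cofinite filter. -/
def mkSHat (f : SYTInf lam → F) (hf : Tendsto f cofinite (𝓝 0)) : SHat F lam where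
  toFun := f
  continuous_toFun := continuous_of_discreteTopology
  zero_at_infty' := by
    rw [cocompact_eq_cofinite]
    exact hf

@[simp]
theorem mkSHat_apply (f : SYTInf lam → F) (hf : Tendsto f cofinite (𝓝 0)) (τ : SYTInf lam) :
    mkSHat f hf τ = f τ := rfl

theorem tendsto_genFun [IsUltrametricDist F] {t : F} (ht : IsPseudoUniformizer t) (i : ℕ)
    (v : SHat F lam) : Tendsto (genFun t i v) cofinite (𝓝 0) := by
  have h1 : Tendsto (fun τ => ‖v τ‖) cofinite (𝓝 0) := by
    simpa using (tendsto_cofinite v).norm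
  have hinj : Function.Injective (swapTab (lam := lam) i) :=
    (show Function.Involutive (swapTab (lam := lam) i) from swapTab_swapTab i).injective
  have h2 : Tendsto (fun τ => ‖v (swapTab i τ)‖) cofinite (𝓝 0) :=
    h1.comp hinj.tendsto_cofinite
  have h3 := h1.max h2
  rw [max_self] at h3
  exact squeeze_zero_norm (norm_genFun_le ht i v) h3

/-- The bounded operator `T_i` on `Ŝ_λ`. -/
def genOp [IsUltrametricDist F] {t : F} (ht : IsPseudoUniformizer t) (lam : YoungDiagram) (i : ℕ) :
    SHat F lam →L[F] SHat F lam :=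
  LinearMap.mkContinuous
    { toFun := fun v => mkSHat (genFun t i v) (tendsto_genFun ht i v)
      map_add' := fun v w => by
        ext τ
        simp only [mkSHat_apply, genFun, ZeroAtInftyContinuousMap.add_apply]
        ring
      map_smul' := fun a v => by
        ext τ
        simp only [mkSHat_apply, genFun, ZeroAtInftyContinuousMap.smul_apply, smul_eq_mul,
          RingHom.id_apply]
        ring }
    1 (fun v => by
      rw [one_mul, ← ZeroAtInftyContinuousMap.norm_toBCF_eq_norm,
        BoundedContinuousFunction.norm_le (norm_nonneg _)]
      intro τ
      exact (norm_genFun_le ht i v τ).trans (max_le (norm_apply_le v _) (norm_apply_le v _)))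

@[simp]
theorem genOp_apply [IsUltrametricDist F] {t : F} (ht : IsPseudoUniformizer t) (i : ℕ)
    (v : SHat F lam) (τ : SYTInf lam) : genOp ht lam i v τ = genFun t i v τ := rfl

open Classical in
/-- The basis vector `e_τ` of `Ŝ_λ`. -/
def basisVec (F : Type*) [NontriviallyNormedField F] {lam : YoungDiagram} (τ : SYTInf lam) :
    SHat F lam :=
  mkSHat (Pi.single τ 1) (by
    refine tendsto_nhds_of_eventually_eq ?_
    filter_upwards [(Set.finite_singleton τ).compl_mem_cofinite] with σ hσ
    exact Pi.single_eq_of_ne hσ _)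

/-! The relations are checked on functions on all bijective fillings. -/

open Classical in
/-- Extension by zero to all bijective fillings. -/
def extFun (c : SYTInf lam → F) (w : InfBox lam ≃ ℕ) : F :=
  if h : IsStandard w then c ⟨w, h⟩ else 0

/-- The operator `T_i` on functions on all bijective fillings. -/
def bigFun (t : F) (i : ℕ) (g : (InfBox lam ≃ ℕ) → F) (w : InfBox lam ≃ ℕ) : F :=
  diagCoeff t (contentDiff w i) * g w + offCoeff t (-contentDiff w i) * g (swapLabels i w)

theorem extFun_coe (c : SYTInf lam → F) (τ : SYTInf lam) : extFun c τ.filling = c τ :=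
  dif_pos τ.standard

theorem offCoeff_eq_zero (t : F) {x : ℤ} (h : ¬ (2 ≤ x ∨ x ≤ -2)) : offCoeff t x = 0 := by
  unfold offCoeff
  rw [if_neg (by omega), if_neg (by omega)]

theorem contentDiff_swapTab (i : ℕ) (τ : SYTInf lam) :
    (2 ≤ contentDiff τ.filling i ∨ contentDiff τ.filling i ≤ -2) ∨
    ¬ (2 ≤ contentDiff (swapTab i τ).filling i ∨ contentDiff (swapTab i τ).filling i ≤ -2) := by
  by_cases h : IsStandard (swapLabels i τ.filling)
  · have h1 : swapTab i τ = ⟨swapLabels i τ.filling, h⟩ := dif_pos h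
    rw [h1]
    have := contentDiff_swapLabels i τ.filling
    show _ ∨ ¬ (2 ≤ contentDiff (swapLabels i τ.filling) i ∨
      contentDiff (swapLabels i τ.filling) i ≤ -2)
    omega
  · have h1 : swapTab i τ = τ := dif_neg h
    rw [h1]
    exact em _

theorem extFun_genFun (t : F) (i : ℕ) (c : SYTInf lam → F) :
    extFun (genFun t i c) = bigFun t i (extFun c) := by
  funext w
  by_cases hw : IsStandard w
  · obtain ⟨τ, rfl⟩ : ∃ τ : SYTInf lam, τ.filling = w := ⟨⟨w, hw⟩, rfl⟩
    rw [extFun_coe]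
    unfold genFun bigFun
    rw [extFun_coe]
    congr 1
    rcases contentDiff_swapTab i τ with h | h
    · rw [swapTab_coe h, contentDiff_swapLabels, ← swapTab_coe h, extFun_coe]
    · rw [offCoeff_eq_zero t h]
      by_cases h2 : 2 ≤ contentDiff τ.filling i ∨ contentDiff τ.filling i ≤ -2
      · rw [swapTab_coe h2, contentDiff_swapLabels] at h
        omega
      · rw [offCoeff_eq_zero t (by omega), zero_mul, zero_mul]
  · have h0 : ∀ c : SYTInf lam → F, extFun c w = 0 := fun c => dif_neg hw
    rw [h0]
    unfold bigFun
    rw [h0, mul_zero, zero_add]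
    by_cases h2 : 2 ≤ contentDiff w i ∨ contentDiff w i ≤ -2
    · have h3 : ¬ IsStandard (swapLabels i w) := by
        intro h4
        have h5 := contentDiff_swapLabels i w
        have h6 := h4.swap (i := i) (by omega)
        rw [swapLabels_swapLabels] at h6
        exact hw h6
      have h4 : extFun c (swapLabels i w) = 0 := dif_neg h3
      rw [h4, mul_zero]
    · rw [offCoeff_eq_zero t (by omega), zero_mul]

theorem bigFun_quad {t : F} (ht : IsPseudoUniformizer t) (i : ℕ) (g : (InfBox lam ≃ ℕ) → F)
    {w : InfBox lam ≃ ℕ} (hw : IsStandard w) :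
    bigFun t i (bigFun t i g) w = (1 - t) * bigFun t i g w + t * g w := by
  have hx := hw.contentDiff_ne_zero i
  unfold bigFun
  rw [contentDiff_swapLabels, swapLabels_swapLabels, neg_neg]
  have h1 := diagCoeff_add ht hx
  have h2 := offCoeff_mul ht hx
  generalize contentDiff w i = x at *
  have h3 : diagCoeff t (-x) = 1 - t - diagCoeff t x := by linear_combination h1
  rw [h3]
  linear_combination g w * h2

theorem swapLabels_comm {i j : ℕ} (h : i + 1 < j) (w : InfBox lam ≃ ℕ) :
    swapLabels i (swapLabels j w) = swapLabels j (swapLabels i w) := by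
  ext b
  simp only [swapLabels, Equiv.trans_apply, Equiv.swap_apply_def]
  split_ifs <;> omega

theorem contentDiff_swap_far {i j : ℕ} (h : i + 1 < j ∨ j + 1 < i) (w : InfBox lam ≃ ℕ) :
    contentDiff (swapLabels i w) j = contentDiff w j := by
  unfold contentDiff
  rw [boxOf_swapLabels, boxOf_swapLabels, Equiv.swap_apply_of_ne_of_ne (by omega) (by omega),
    Equiv.swap_apply_of_ne_of_ne (by omega) (by omega)]

theorem bigFun_comm (t : F) {i j : ℕ} (h : i + 1 < j) (g : (InfBox lam ≃ ℕ) → F)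
    (w : InfBox lam ≃ ℕ) :
    bigFun t i (bigFun t j g) w = bigFun t j (bigFun t i g) w := by
  unfold bigFun
  rw [contentDiff_swap_far (Or.inl h), contentDiff_swap_far (Or.inr h), swapLabels_comm h]
  ring

theorem contentDiff_swap_succ (i : ℕ) (w : InfBox lam ≃ ℕ) :
    contentDiff (swapLabels i w) (i + 1) = contentDiff w i + contentDiff w (i + 1) := by
  unfold contentDiff
  rw [boxOf_swapLabels, boxOf_swapLabels, Equiv.swap_apply_right,
    Equiv.swap_apply_of_ne_of_ne (by omega) (by omega)]
  ring

theorem contentDiff_succ_swap (i : ℕ) (w : InfBox lam ≃ ℕ) :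
    contentDiff (swapLabels (i + 1) w) i = contentDiff w i + contentDiff w (i + 1) := by
  unfold contentDiff
  rw [boxOf_swapLabels, boxOf_swapLabels, Equiv.swap_apply_left,
    Equiv.swap_apply_of_ne_of_ne (by omega) (by omega)]
  ring

theorem swapLabels_braid (i : ℕ) (w : InfBox lam ≃ ℕ) :
    swapLabels i (swapLabels (i + 1) (swapLabels i w)) =
      swapLabels (i + 1) (swapLabels i (swapLabels (i + 1) w)) := by
  ext b
  simp only [swapLabels, Equiv.trans_apply, Equiv.swap_apply_def]
  split_ifs <;> omega

theorem bigFun_braid {t : F} (ht : IsPseudoUniformizer t) (i : ℕ) (g : (InfBox lam ≃ ℕ) → F)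
    {w : InfBox lam ≃ ℕ} (hw : IsStandard w) :
    bigFun t i (bigFun t (i + 1) (bigFun t i g)) w =
      bigFun t (i + 1) (bigFun t i (bigFun t (i + 1) g)) w := by
  have hx := hw.contentDiff_ne_zero i
  have hy := hw.contentDiff_ne_zero (i + 1)
  have hz := hw.contentDiff_add_ne_zero i
  simp only [bigFun, contentDiff_swapLabels, swapLabels_swapLabels, contentDiff_swap_succ,
    contentDiff_succ_swap, swapLabels_braid]
  generalize contentDiff w i = x at *
  generalize contentDiff w (i + 1) = y at *
  have e1 : -x + (x + y) = y := by ring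
  have e2 : x + y + -y = x := by ring
  have a1 := diagCoeff_triple ht hx hy hz
  have a2 := diagCoeff_triple ht hy hx (by omega)
  have b1 := offCoeff_mul ht hx
  have b2 := offCoeff_mul ht hy
  have c1 := diagCoeff_add ht hx
  have e3 : y + x = x + y := by ring
  rw [e3] at a2
  simp only [e1, e2, neg_neg]
  linear_combination g w * (diagCoeff t (x + y) * b1 - diagCoeff t (x + y) * b2 +
      (diagCoeff t x - diagCoeff t y) * (a1 - diagCoeff t (x + y) * c1)) +
    offCoeff t (-x) * g (swapLabels i w) * a1 - offCoeff t (-y) * g (swapLabels (i + 1) w) * a2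

end operators

/-! ### The infinite Hecke algebra -/

section algebra

variable {F : Type*} [NontriviallyNormedField F]

/-- The defining relations: `(T_i - 1)(T_i + t) = 0`, `T_i T_j = T_j T_i` for `|i - j| > 1`, and
`T_i T_{i+1} T_i = T_{i+1} T_i T_{i+1}`. -/
inductive HeckeRel (t : F) : FreeAlgebra F ℕ → FreeAlgebra F ℕ → Prop
  | quad (i : ℕ) : HeckeRel t
      ((FreeAlgebra.ι F i - 1) * (FreeAlgebra.ι F i + algebraMap F (FreeAlgebra F ℕ) t)) 0
  | comm (i j : ℕ) (h : i + 1 < j) : HeckeRel t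
      (FreeAlgebra.ι F i * FreeAlgebra.ι F j) (FreeAlgebra.ι F j * FreeAlgebra.ι F i)
  | braid (i : ℕ) : HeckeRel t
      (FreeAlgebra.ι F i * FreeAlgebra.ι F (i + 1) * FreeAlgebra.ι F i)
      (FreeAlgebra.ι F (i + 1) * FreeAlgebra.ι F i * FreeAlgebra.ι F (i + 1))

/-- The infinite Hecke algebra `H_∞`. -/
abbrev InfHecke (t : F) : Type _ := RingQuot (HeckeRel t)

/-- The generators `T_i` of `H_∞`. -/
def gen (t : F) (i : ℕ) : InfHecke t :=
  RingQuot.mkAlgHom F (HeckeRel t) (FreeAlgebra.ι F i)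

theorem gen_quad (t : F) (i : ℕ) :
    (gen t i - 1) * (gen t i + algebraMap F (InfHecke t) t) = 0 := by
  simpa [gen] using RingQuot.mkAlgHom_rel F (HeckeRel.quad (t := t) i)

theorem gen_comm (t : F) {i j : ℕ} (h : i + 1 < j) : gen t i * gen t j = gen t j * gen t i := by
  simpa [gen] using RingQuot.mkAlgHom_rel F (HeckeRel.comm (t := t) i j h)

theorem gen_braid (t : F) (i : ℕ) :
    gen t i * gen t (i + 1) * gen t i = gen t (i + 1) * gen t i * gen t (i + 1) := by
  simpa [gen] using RingQuot.mkAlgHom_rel F (HeckeRel.braid (t := t) i)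

/-- The universal property of `H_∞`. -/
def liftHecke (t : F) {A : Type*} [Ring A] [Algebra F A] (f : ℕ → A)
    (hquad : ∀ i, (f i - 1) * (f i + algebraMap F A t) = 0)
    (hcomm : ∀ i j, i + 1 < j → f i * f j = f j * f i)
    (hbraid : ∀ i, f i * f (i + 1) * f i = f (i + 1) * f i * f (i + 1)) :
    InfHecke t →ₐ[F] A :=
  RingQuot.liftAlgHom F ⟨FreeAlgebra.lift F f, by
    intro x y h
    cases h with
    | quad i => simpa using hquad i
    | comm i j h => simpa using hcomm i j h
    | braid i => simpa using hbraid i⟩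

theorem liftHecke_gen (t : F) {A : Type*} [Ring A] [Algebra F A] (f : ℕ → A)
    (hquad : ∀ i, (f i - 1) * (f i + algebraMap F A t) = 0)
    (hcomm : ∀ i j, i + 1 < j → f i * f j = f j * f i)
    (hbraid : ∀ i, f i * f (i + 1) * f i = f (i + 1) * f i * f (i + 1)) (i : ℕ) :
    liftHecke t f hquad hcomm hbraid (gen t i) = f i := by
  unfold liftHecke gen
  rw [RingQuot.liftAlgHom_mkAlgHom_apply, FreeAlgebra.lift_ι_apply]

theorem hecke_algHom_ext {t : F} {A : Type*} [Ring A] [Algebra F A] {f g : InfHecke t →ₐ[F] A}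
    (h : ∀ i, f (gen t i) = g (gen t i)) : f = g := by
  apply RingQuot.ringQuot_ext'
  apply FreeAlgebra.hom_ext
  funext i
  exact h i

/-- The homomorphism from `H_∞` to its opposite algebra which fixes each `T_i`. -/
def antiHom (t : F) : InfHecke t →ₐ[F] (InfHecke t)ᵐᵒᵖ :=
  liftHecke t (fun i => MulOpposite.op (gen t i))
    (fun i => by
      apply MulOpposite.unop_injective
      have h : (gen t i + algebraMap F (InfHecke t) t) * (gen t i - 1) = 0 := by
        rw [← gen_quad t i]
        have hc := Algebra.commutes t (gen t i)
        simp only [add_mul, mul_sub, sub_mul, mul_add, mul_one, one_mul]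
        rw [hc]
        abel
      simpa using h)
    (fun i j h => by
      apply MulOpposite.unop_injective
      simpa using (gen_comm t h).symm)
    (fun i => by
      apply MulOpposite.unop_injective
      simpa [mul_assoc] using gen_braid t i)

theorem antiHom_gen (t : F) (i : ℕ) : antiHom t (gen t i) = MulOpposite.op (gen t i) :=
  liftHecke_gen t _ _ _ _ i

theorem antiHom_antiHom (t : F) (X : InfHecke t) :
    (antiHom t (antiHom t X).unop).unop = X := by
  have h : ((AlgHom.opComm (antiHom t)).comp (antiHom t)) = AlgHom.id F _ := by
    apply hecke_algHom_ext
    intro i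
    simp [antiHom_gen, AlgHom.opComm]
  simpa [AlgHom.opComm] using DFunLike.congr_fun h X

/-- The linear anti-automorphism `ι` of `H_∞` with `ι(T_i) = T_i`, as an isomorphism onto the
opposite algebra. -/
def iota (t : F) : InfHecke t ≃ₐ[F] (InfHecke t)ᵐᵒᵖ :=
  AlgEquiv.ofBijective (antiHom t)
    ⟨fun X Y h => by rw [← antiHom_antiHom t X, ← antiHom_antiHom t Y, h],
      fun Y => ⟨(antiHom t Y.unop).unop, MulOpposite.unop_injective (antiHom_antiHom t Y.unop)⟩⟩

theorem iota_gen (t : F) (i : ℕ) : iota t (gen t i) = MulOpposite.op (gen t i) :=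
  antiHom_gen t i

theorem iota_unique (t : F) (f : InfHecke t ≃ₐ[F] (InfHecke t)ᵐᵒᵖ)
    (hf : ∀ i, f (gen t i) = MulOpposite.op (gen t i)) : f = iota t := by
  have h : (f : InfHecke t →ₐ[F] (InfHecke t)ᵐᵒᵖ) = (iota t : InfHecke t →ₐ[F] _) :=
    hecke_algHom_ext fun i => by
      show f (gen t i) = iota t (gen t i)
      rw [hf, iota_gen]
  ext X
  exact DFunLike.congr_fun h X

/-- A word `i₁ … i_r` is a reduced expression of the permutation `σ`: `σ = s_{i₁} ⋯ s_{i_r}`, and no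
shorter word has product `σ`. -/
def IsReducedExpr (w : List ℕ) (σ : Equiv.Perm ℕ) : Prop :=
  (w.map fun i => Equiv.swap i (i + 1)).prod = σ ∧
    ∀ w' : List ℕ, (w'.map fun i => Equiv.swap i (i + 1)).prod = σ → w.length ≤ w'.length

/-- The product `T_{i₁} ⋯ T_{i_r}`; it is `T_σ` if `i₁ … i_r` is a reduced expression of `σ`. -/
def wordProd (t : F) (w : List ℕ) : InfHecke t := (w.map (gen t)).prod

end algebra

/-- Every permutation of `ℕ` with finite support has a reduced expression. -/
theorem exists_isReducedExpr (σ : Equiv.Perm ℕ) (hσ : {k | σ k ≠ k}.Finite) :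
    ∃ w, IsReducedExpr w σ := by
  have move : ∀ d m : ℕ, ∃ w : List ℕ,
      (w.map fun i => Equiv.swap i (i + 1)).prod m = m + d ∧
      ∀ k, m + d < k → (w.map fun i => Equiv.swap i (i + 1)).prod k = k := by
    intro d
    induction d with
    | zero => exact fun m => ⟨[], by simp, by simp⟩
    | succ d ih =>
      intro m
      obtain ⟨w, h1, h2⟩ := ih m
      refine ⟨(m + d) :: w, ?_, fun k hk => ?_⟩
      · simp only [List.map_cons, List.prod_cons, Equiv.Perm.mul_apply, h1]
        exact Equiv.swap_apply_left _ _
      · simp only [List.map_cons, List.prod_cons, Equiv.Perm.mul_apply]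
        rw [h2 k (by omega)]
        exact Equiv.swap_apply_of_ne_of_ne (by omega) (by omega)
  have inv : ∀ w : List ℕ, (w.reverse.map fun i => Equiv.swap i (i + 1)).prod =
      (w.map fun i => Equiv.swap i (i + 1)).prod⁻¹ := by
    intro w
    induction w with
    | nil => simp
    | cons i w ih =>
      rw [List.reverse_cons, List.map_append, List.prod_append, ih]
      simp [Equiv.swap_inv]
  have main : ∀ n : ℕ, ∀ σ : Equiv.Perm ℕ, (∀ k, n ≤ k → σ k = k) →
      ∃ w : List ℕ, (w.map fun i => Equiv.swap i (i + 1)).prod = σ := by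
    intro n
    induction n with
    | zero =>
      intro σ h
      refine ⟨[], ?_⟩
      ext k
      simp [h k (Nat.zero_le k)]
    | succ n ih =>
      intro σ h
      have hle : σ n ≤ n := by
        by_contra hcon
        have h1 := h (σ n) (by omega)
        have h2 := σ.injective h1
        omega
      obtain ⟨u, h1, h2⟩ := move (n - σ n) (σ n)
      rw [Nat.add_sub_cancel' hle] at h1 h2
      obtain ⟨v, hv⟩ := ih ((u.map fun i => Equiv.swap i (i + 1)).prod * σ) (by
        intro k hk
        rw [Equiv.Perm.mul_apply]
        rcases hk.lt_or_eq with h' | h'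
        · rw [h k (by omega), h2 k h']
        · rw [← h', h1])
      refine ⟨u.reverse ++ v, ?_⟩
      rw [List.map_append, List.prod_append, inv, hv, inv_mul_cancel_left]
  obtain ⟨B, hB⟩ := hσ.bddAbove
  have hex : ∃ w : List ℕ, (w.map fun i => Equiv.swap i (i + 1)).prod = σ := by
    refine main (B + 1) σ fun k hk => ?_
    by_contra hcon
    have : k ≤ B := hB hcon
    omega
  classical
  have hlen : ∃ n, ∃ w : List ℕ,
      (w.map fun i => Equiv.swap i (i + 1)).prod = σ ∧ w.length = n := by
    obtain ⟨w, hw⟩ := hex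
    exact ⟨w.length, w, hw, rfl⟩
  obtain ⟨w, hw, hwn⟩ := Nat.find_spec hlen
  refine ⟨w, hw, fun w' hw' => ?_⟩
  rw [hwn]
  exact Nat.find_min' hlen ⟨w', hw', rfl⟩

/-! ### The representation, the inner product and the regularized trace -/

theorem clm_ext_extFun {F : Type*} [NontriviallyNormedField F] {lam : YoungDiagram} {A B : SHat F lam →L[F] SHat F lam}
    (h : ∀ v : SHat F lam, ∀ τ : SYTInf lam,
      extFun (A v) τ.filling = extFun (B v) τ.filling) : A = B := by
  ext v τ
  have := h v τ
  rwa [extFun_coe, extFun_coe] at this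

section trace

variable {F : Type*} [NontriviallyNormedField F] [IsUltrametricDist F] {t : F}
  {lam : YoungDiagram}

theorem quad_expand {F A : Type*} [Field F] [Ring A] [Algebra F A] (T : A) (t : F) :
    (T - 1) * (T + algebraMap F A t) = T * T - (1 - t) • T - t • (1 : A) := by
  rw [Algebra.algebraMap_eq_smul_one, sub_mul, mul_add, mul_add, one_mul, one_mul,
    mul_smul_comm, mul_one, sub_smul, one_smul]
  abel

variable (lam) in
/-- The representation of `H_∞` on `Ŝ_λ` by bounded operators. -/
def rep (ht : IsPseudoUniformizer t) : InfHecke t →ₐ[F] (SHat F lam →L[F] SHat F lam) :=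
  liftHecke t (genOp ht lam)
    (fun i => by
      apply clm_ext_extFun
      intro v τ
      have h := bigFun_quad ht i (extFun v) τ.standard
      rw [← extFun_genFun, ← extFun_genFun, extFun_coe, extFun_coe, extFun_coe] at h
      rw [extFun_coe, extFun_coe]
      rw [quad_expand]
      have e2 : ((genOp ht lam i * genOp ht lam i - (1 - t) • genOp ht lam i - t • 1 :
          SHat F lam →L[F] SHat F lam) v) τ =
          genFun t i (genFun t i v) τ - (1 - t) * genFun t i v τ - t * v τ := rfl
      rw [e2, h]
      show _ = (0 : F)
      ring)
    (fun i j hij => by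
      apply clm_ext_extFun
      intro v τ
      show extFun (genFun t i (genFun t j v)) _ = extFun (genFun t j (genFun t i v)) _
      simp only [extFun_genFun]
      exact bigFun_comm t hij _ _)
    (fun i => by
      apply clm_ext_extFun
      intro v τ
      show extFun (genFun t i (genFun t (i + 1) (genFun t i v))) _ =
        extFun (genFun t (i + 1) (genFun t i (genFun t (i + 1) v))) _
      simp only [extFun_genFun]
      exact bigFun_braid ht i _ τ.standard)

theorem rep_gen (ht : IsPseudoUniformizer t) (i : ℕ) : rep lam ht (gen t i) = genOp ht lam i :=
  liftHecke_gen t _ _ _ _ i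

end trace

section form

variable {F : Type*} [NontriviallyNormedField F] {lam : YoungDiagram}

/-- The scalars `a(τ) = (e_τ, e_τ)_λ`, with one factor `t` for each of the `inv(τ)` inversions. -/
def normCoeff (t : F) (τ : SYTInf lam) : F :=
  ∏ p ∈ Inv τ, t * ((1 - t ^ (p.2.content - p.1.content - 1)) *
    (1 - t ^ (p.2.content - p.1.content + 1))) / (1 - t ^ (p.2.content - p.1.content)) ^ 2

/-- The renormalized basis vector `ẽ_τ`. -/
def renormVec (t : F) (τ : SYTInf lam) : SHat F lam :=
  (∏ p ∈ Inv τ, (1 - t ^ (p.2.content - p.1.content)) /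
    (1 - t ^ (p.2.content - p.1.content + 1))) • basisVec F τ

/-- The inner product `(v, w)_λ = ∑ v_τ w_τ a(τ)` on `Ŝ_λ`. -/
def form (t : F) (v w : SHat F lam) : F :=
  ∑' τ : SYTInf lam, v τ * w τ * normCoeff t τ

variable {t : F}

theorem mem_Inv {τ : SYTInf lam} {p : InfBox lam × InfBox lam} :
    p ∈ Inv τ ↔ (colStd lam).filling p.1 < (colStd lam).filling p.2 ∧
      τ.filling p.2 < τ.filling p.1 := by
  simp [Inv, invSet]

theorem norm_normCoeff [IsUltrametricDist F] (ht : IsPseudoUniformizer t) (τ : SYTInf lam) :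
    ‖normCoeff t τ‖ = ‖t‖ ^ (Inv τ).card := by
  unfold normCoeff
  rw [norm_prod]
  refine Finset.prod_eq_pow_card fun p hp => ?_
  have h : 2 ≤ p.2.content - p.1.content := invSet_content (mem_Inv.1 hp)
  rw [norm_div, norm_mul, norm_mul, norm_pow, norm_one_sub_zpow ht (by omega),
    norm_one_sub_zpow ht (by omega), norm_one_sub_zpow ht (by omega)]
  simp

/-- The series defining the inner product converges. -/
theorem form_summable [IsUltrametricDist F] [CompleteSpace F] (ht : IsPseudoUniformizer t)
    (v w : SHat F lam) : Summable fun τ : SYTInf lam => v τ * w τ * normCoeff t τ := by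
  apply NonarchimedeanAddGroup.summable_of_tendsto_cofinite_zero
  have h1 : Tendsto (fun τ => ‖v τ‖ * ‖w τ‖) cofinite (𝓝 0) := by
    simpa using (tendsto_cofinite v).norm.mul (tendsto_cofinite w).norm
  refine squeeze_zero_norm (fun τ => ?_) h1
  rw [norm_mul, norm_mul, norm_normCoeff ht]
  exact mul_le_of_le_one_right (by positivity) (pow_le_one₀ (norm_nonneg _) ht.2.le)

theorem normCoeff_colStd (t : F) : normCoeff t (colStd lam) = 1 := by
  have h : Inv (colStd lam) = ∅ := by
    ext p
    simp only [mem_Inv, Finset.notMem_empty, iff_false]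
    omega
  rw [normCoeff, h, Finset.prod_empty]

/-- The recursion for `a` along the cover relations `s_i(τ) > τ`. -/
theorem normCoeff_swapTab (t : F) (τ : SYTInf lam) (i : ℕ) (h : 2 ≤ contentDiff τ.filling i) :
    normCoeff t (swapTab i τ) =
      t * ((1 - t ^ (contentDiff τ.filling i - 1)) * (1 - t ^ (contentDiff τ.filling i + 1))) /
        (1 - t ^ contentDiff τ.filling i) ^ 2 * normCoeff t τ := by
  set P := boxOf τ.filling i with hP
  set Q := boxOf τ.filling (i + 1) with hQ
  have hp : τ.filling P = i := τ.filling.apply_symm_apply i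
  have hq : τ.filling Q = i + 1 := τ.filling.apply_symm_apply (i + 1)
  have hpos := τ.standard.position i
  have hd : contentDiff τ.filling i = Q.content - P.content := rfl
  have hcol : P.col < Q.col := by
    unfold contentDiff InfBox.content at h
    rw [← hP, ← hQ] at hpos h
    omega
  have hcs : (colStd lam).filling P < (colStd lam).filling Q := colReading_lt hcol
  have hs : (swapTab i τ).filling = swapLabels i τ.filling := swapTab_coe (Or.inl h)
  have hiff : ∀ a b : InfBox lam, (a, b) ∈ Inv (swapTab i τ) ↔
      ((a, b) = (P, Q) ∨ (a, b) ∈ Inv τ) := by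
    intro a b
    rw [mem_Inv, mem_Inv, hs]
    simp only [Prod.mk.injEq]
    have ha : τ.filling a = i ↔ a = P := by
      rw [← hp]; exact τ.filling.injective.eq_iff
    have ha' : τ.filling a = i + 1 ↔ a = Q := by
      rw [← hq]; exact τ.filling.injective.eq_iff
    have hb : τ.filling b = i ↔ b = P := by
      rw [← hp]; exact τ.filling.injective.eq_iff
    have hb' : τ.filling b = i + 1 ↔ b = Q := by
      rw [← hq]; exact τ.filling.injective.eq_iff
    constructor
    · rintro ⟨h1, h2⟩
      by_cases h3 : a = P ∧ b = Q
      · exact Or.inl h3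
      · refine Or.inr ⟨h1, ?_⟩
        have h4 : ¬ (a = Q ∧ b = P) := by
          rintro ⟨rfl, rfl⟩
          omega
        rw [← ha, ← hb'] at h3
        rw [← ha', ← hb] at h4
        simp only [swapLabels, Equiv.trans_apply, Equiv.swap_apply_def] at h2
        split_ifs at h2 <;> omega
    · rintro (⟨rfl, rfl⟩ | ⟨h1, h2⟩)
      · refine ⟨hcs, ?_⟩
        simp [swapLabels, hp, hq]
      · refine ⟨h1, ?_⟩
        have h4 : ¬ (a = Q ∧ b = P) := by
          rintro ⟨rfl, rfl⟩
          omega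
        rw [← ha', ← hb] at h4
        simp only [swapLabels, Equiv.trans_apply, Equiv.swap_apply_def]
        split_ifs <;> omega
  have hnot : (P, Q) ∉ Inv τ := by
    rw [mem_Inv]
    rintro ⟨-, h2⟩
    simp only at h2
    omega
  classical
  have hins : Inv (swapTab i τ) = insert (P, Q) (Inv τ) := by
    ext ⟨a, b⟩
    rw [Finset.mem_insert]
    exact hiff a b
  unfold normCoeff
  rw [hins, Finset.prod_insert hnot, hd]

end form

section action

variable {F : Type*} [NontriviallyNormedField F] [IsUltrametricDist F] {t : F}
  {lam : YoungDiagram}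

theorem basisVec_apply (τ σ : SYTInf lam) [Decidable (σ = τ)] :
    basisVec F τ σ = if σ = τ then 1 else 0 := by
  classical
  have h : basisVec F τ σ = (Pi.single τ (1 : F) : SYTInf lam → F) σ := by
    unfold basisVec
    rw [mkSHat_apply]
  rw [h, Pi.single_apply]
  congr

theorem genOp_basisVec (ht : IsPseudoUniformizer t) (i : ℕ) (τ : SYTInf lam) :
    genOp ht lam i (basisVec F τ) = offCoeff t (contentDiff τ.filling i) • basisVec F (swapTab i τ)
      + diagCoeff t (contentDiff τ.filling i) • basisVec F τ := by
  classical
  ext σ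
  have hinv : swapTab i σ = τ ↔ σ = swapTab i τ :=
    ⟨fun h => by rw [← h, swapTab_swapTab], fun h => by rw [h, swapTab_swapTab]⟩
  simp only [genOp_apply, genFun, ZeroAtInftyContinuousMap.add_apply,
    ZeroAtInftyContinuousMap.smul_apply, smul_eq_mul, basisVec_apply, hinv]
  by_cases h1 : σ = swapTab i τ <;> by_cases h2 : σ = τ
  · subst h2
    simp [← h1, add_comm]
  · subst h1
    simp [h2, swapTab_swapTab]
  · subst h2
    simp [h1]
  · simp [h1, h2]

/-- If `i+1` is strictly to the right and above `i`, then `s_i(τ) > τ`. -/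
theorem genOp_basisVec_up (ht : IsPseudoUniformizer t) (i : ℕ) (τ : SYTInf lam)
    (hr : (boxOf τ.filling (i + 1)).row < (boxOf τ.filling i).row)
    (hc : (boxOf τ.filling i).col < (boxOf τ.filling (i + 1)).col) :
    genOp ht lam i (basisVec F τ) = basisVec F (swapTab i τ) +
      ((1 - t) / (1 - t ^ contentDiff τ.filling i)) • basisVec F τ := by
  have hx : 2 ≤ contentDiff τ.filling i := by
    unfold contentDiff InfBox.content
    omega
  rw [genOp_basisVec, offCoeff, if_pos hx, one_smul]
  rfl

/-- If `i` is strictly to the right and above `i+1`, then `s_i(τ) < τ`. -/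
theorem genOp_basisVec_down (ht : IsPseudoUniformizer t) (i : ℕ) (τ : SYTInf lam)
    (hr : (boxOf τ.filling i).row < (boxOf τ.filling (i + 1)).row)
    (hc : (boxOf τ.filling (i + 1)).col < (boxOf τ.filling i).col) :
    genOp ht lam i (basisVec F τ) =
      (t * ((1 - t ^ (-contentDiff τ.filling i - 1)) * (1 - t ^ (-contentDiff τ.filling i + 1))) /
        (1 - t ^ (-contentDiff τ.filling i)) ^ 2) • basisVec F (swapTab i τ) -
      (t ^ (-contentDiff τ.filling i) * ((1 - t) / (1 - t ^ (-contentDiff τ.filling i)))) •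
        basisVec F τ := by
  have hx : contentDiff τ.filling i ≤ -2 := by
    unfold contentDiff InfBox.content
    omega
  have hdiag : diagCoeff t (contentDiff τ.filling i) =
      -(t ^ (-contentDiff τ.filling i) * ((1 - t) / (1 - t ^ (-contentDiff τ.filling i)))) := by
    have h1 := one_sub_zpow_ne_zero ht (k := contentDiff τ.filling i) (by omega)
    have h0 : t ^ contentDiff τ.filling i ≠ 0 := zpow_ne_zero _ ht.ne_zero
    unfold diagCoeff
    rw [zpow_neg]
    generalize t ^ contentDiff τ.filling i = u at *
    have h3 : u - 1 ≠ 0 := fun h => h1 (by linear_combination -h)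
    have h4 : 1 - u⁻¹ = (u - 1) / u := by field_simp
    rw [h4]
    field_simp
    ring
  rw [genOp_basisVec, hdiag, offCoeff, if_neg (by omega), if_pos hx]
  module

/-- If `i` and `i+1` are in the same row, then `T_i(e_τ) = e_τ`. -/
theorem genOp_basisVec_row (ht : IsPseudoUniformizer t) (i : ℕ) (τ : SYTInf lam)
    (hr : (boxOf τ.filling i).row = (boxOf τ.filling (i + 1)).row) :
    genOp ht lam i (basisVec F τ) = basisVec F τ := by
  have hx : contentDiff τ.filling i = 1 := by
    have := τ.standard.position i
    unfold contentDiff InfBox.content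
    omega
  have h2 : 1 - t ≠ 0 := by simpa using one_sub_zpow_ne_zero ht (k := 1) (by omega)
  rw [genOp_basisVec, hx, offCoeff_eq_zero t (by omega), zero_smul, zero_add, diagCoeff, zpow_one,
    div_self h2, one_smul]

/-- If `i` and `i+1` are in the same column, then `T_i(e_τ) = -t e_τ`. -/
theorem genOp_basisVec_col (ht : IsPseudoUniformizer t) (i : ℕ) (τ : SYTInf lam)
    (hc : (boxOf τ.filling i).col = (boxOf τ.filling (i + 1)).col) :
    genOp ht lam i (basisVec F τ) = (-t) • basisVec F τ := by
  have hx : contentDiff τ.filling i = -1 := by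
    have := τ.standard.position i
    unfold contentDiff InfBox.content
    omega
  have h2 : 1 - t ≠ 0 := by simpa using one_sub_zpow_ne_zero ht (k := 1) (by omega)
  rw [genOp_basisVec, hx, offCoeff_eq_zero t (by omega), zero_smul, zero_add]
  congr 1
  have h0 := ht.ne_zero
  have h3 : t - 1 ≠ 0 := fun h => h2 (by linear_combination -h)
  have h4 : 1 - t⁻¹ = (t - 1) / t := by field_simp
  rw [diagCoeff, zpow_neg, zpow_one, h4]
  field_simp
  ring

/-- The term `(X(ẽ_τ), ẽ_τ)_λ` of the regularized trace. -/
def traceTerm (ht : IsPseudoUniformizer t) (lam : YoungDiagram) (X : InfHecke t)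
    (τ : SYTInf lam) : F :=
  form t (rep lam ht X (renormVec t τ)) (renormVec t τ)

/-- The regularized trace `Γ_λ(X) = ∑_τ (X(ẽ_τ), ẽ_τ)_λ`. -/
def regTrace (ht : IsPseudoUniformizer t) (lam : YoungDiagram) (X : InfHecke t) : F :=
  ∑' τ : SYTInf lam, traceTerm ht lam X τ

end action

end HeckeTrace

end

/-! The invariance holds tableau by tableau. In the basis `e_τ` each `T_i` has a diagonal part and a
part linking `τ` with `s_i(τ)`, and the weights `a(τ)` balance the two linking coefficients
(`offCoeff_mul_normCoeff_swapTab`). So every `T_i` is self-adjoint for the inner product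
(`form_genOp`), and the adjoint of any `X` is `ι(X)`, because passing to adjoints reverses products
(`form_rep`). As the form is symmetric, `(ι(X)ẽ_τ, ẽ_τ) = (ẽ_τ, ι(X)ẽ_τ) = (Xẽ_τ, ẽ_τ)`, and the two
traces agree term by term.

Convergence only requires the terms to tend to `0`, since `F` is complete and non-archimedean. Every
`1 - t^k` with `k ≥ 1` has absolute value `1`, so the renormalizing factor of `ẽ_τ` has absolute
value `1` and `|a(τ)| = |t|^inv(τ)`. With the boundedness of `X` this gives `|(Xẽ_τ, ẽ_τ)| ≤ ‖X‖
|t|^inv(τ)` (`norm_traceTerm_le`). Only finitely many tableaux have at most `n` inversions: the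
inversion number bounds the finitely many labels below the infinite row, and these labels determine
the tableau (`finite_card_Inv_le`).

For `T_σ`, `ι` reverses words, and reversal turns a reduced expression of `σ` into one of `σ⁻¹`. To
compare it with an arbitrary reduced expression of `σ⁻¹`, Matsumoto's theorem is proved from the
exchange condition (`wordProd_eq_of_isReducedExpr`). -/

noncomputable section

namespace HeckeTrace

/-! ### Independence of the reduced expression -/

/-- The permutation `s_{i₁} ⋯ s_{i_r}` represented by a word. -/
abbrev wordPerm (w : List ℕ) : Equiv.Perm ℕ := (w.map fun i => Equiv.swap i (i + 1)).prod

theorem wordPerm_cons (i : ℕ) (w : List ℕ) :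
    wordPerm (i :: w) = Equiv.swap i (i + 1) * wordPerm w := by
  simp [wordPerm]

theorem wordPerm_reverse (w : List ℕ) : wordPerm w.reverse = (wordPerm w)⁻¹ := by
  induction w with
  | nil => simp [wordPerm]
  | cons i w ih =>
    rw [wordPerm_cons, mul_inv_rev, ← ih, Equiv.swap_inv]
    simp [wordPerm]

/-- Reversal preserves length and matches the words for `σ` with those for `σ⁻¹`, so minimality
carries over. -/
theorem IsReducedExpr.reverse {w : List ℕ} {σ : Equiv.Perm ℕ} (h : IsReducedExpr w σ) :
    IsReducedExpr w.reverse σ⁻¹ := by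
  refine ⟨by rw [← h.1]; exact wordPerm_reverse w, fun w' hw' => ?_⟩
  rw [List.length_reverse, ← w'.length_reverse]
  refine h.2 _ ((wordPerm_reverse w').trans ?_)
  rw [wordPerm, hw', inv_inv]

/-- The exchange condition: if a transposition lowers the permutation of a word, then the product
has a shorter word. -/
theorem exists_shorter_word (u : List ℕ) : ∀ a b : ℕ, a < b →
    (wordPerm u)⁻¹ b < (wordPerm u)⁻¹ a →
    ∃ v : List ℕ, v.length < u.length ∧ wordPerm v = Equiv.swap a b * wordPerm u := by
  induction u with
  | nil =>
    intro a b hab h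
    simp [wordPerm] at h
    omega
  | cons j u ih =>
    intro a b hab h
    rw [wordPerm_cons, mul_inv_rev, Equiv.swap_inv, Equiv.Perm.mul_apply,
      Equiv.Perm.mul_apply] at h
    -- An adjacent transposition `s_j` preserves `a < b` unless `(a, b) = (j, j + 1)`. In that case
    -- the transposition cancels the first letter. Otherwise the induction hypothesis applies to the
    -- images of `a` and `b` under `s_j`.
    by_cases hj : a = j ∧ b = j + 1
    · obtain ⟨rfl, rfl⟩ := hj
      exact ⟨u, by simp, by rw [wordPerm_cons, Equiv.swap_mul_self_mul]⟩
    · have hlt : Equiv.swap j (j + 1) a < Equiv.swap j (j + 1) b := by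
        simp only [Equiv.swap_apply_def]
        split_ifs <;> omega
      obtain ⟨v, hv, hp⟩ := ih _ _ hlt h
      refine ⟨j :: v, by simpa using hv, ?_⟩
      -- The transposition of `s_j a` and `s_j b` is the conjugate of that of `a` and `b` by `s_j`,
      -- so prefixing `j` moves it to the front.
      rw [wordPerm_cons, wordPerm_cons, hp, Equiv.swap_apply_apply, Equiv.swap_inv]
      simp only [← mul_assoc, Equiv.swap_mul_self, one_mul]

/-- The exchange condition gives only an upper bound on the length of the new word; by minimality of
`w` this suffices for the new word to be reduced. -/
theorem IsReducedExpr.of_length_le {w w' : List ℕ} {σ : Equiv.Perm ℕ} (h : IsReducedExpr w σ)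
    (hp : wordPerm w' = σ) (hl : w'.length ≤ w.length) : IsReducedExpr w' σ :=
  ⟨hp, fun v hv => hl.trans (h.2 v hv)⟩

theorem IsReducedExpr.tail {i : ℕ} {u : List ℕ} {σ : Equiv.Perm ℕ}
    (h : IsReducedExpr (i :: u) σ) : IsReducedExpr u (Equiv.swap i (i + 1) * σ) := by
  have h1 : Equiv.swap i (i + 1) * wordPerm u = σ := by rw [← wordPerm_cons]; exact h.1
  refine ⟨?_, fun v hv => ?_⟩
  · rw [← h1, Equiv.swap_mul_self_mul]
  · have := h.2 (i :: v) (by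
      change wordPerm (i :: v) = σ
      rw [wordPerm_cons, wordPerm, hv, Equiv.swap_mul_self_mul])
    simpa using this

/-- The first letter of a reduced expression is a descent. -/
theorem IsReducedExpr.descent {i : ℕ} {u : List ℕ} {σ : Equiv.Perm ℕ}
    (h : IsReducedExpr (i :: u) σ) : σ⁻¹ (i + 1) < σ⁻¹ i := by
  by_contra hcon
  have hne : σ⁻¹ i ≠ σ⁻¹ (i + 1) := fun h => by simpa using σ⁻¹.injective h
  have hu : wordPerm u = Equiv.swap i (i + 1) * σ := h.tail.1
  -- If `i` were not a descent of `σ`, it would be one of `s_i σ`, which `u` represents. Exchange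
  -- would then give a word for `σ` shorter than `u`.
  obtain ⟨v, hv, hp⟩ := exists_shorter_word u i (i + 1) (by omega) (by
    rw [hu, mul_inv_rev, Equiv.swap_inv, Equiv.Perm.mul_apply, Equiv.Perm.mul_apply,
      Equiv.swap_apply_left, Equiv.swap_apply_right]
    omega)
  rw [hu, Equiv.swap_mul_self_mul] at hp
  have := h.2 v hp
  simp only [List.length_cons] at this
  omega

theorem swap_mul_inv_apply (i k : ℕ) (σ : Equiv.Perm ℕ) :
    (Equiv.swap i (i + 1) * σ)⁻¹ k = σ⁻¹ (Equiv.swap i (i + 1) k) := by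
  rw [mul_inv_rev, Equiv.swap_inv, Equiv.Perm.mul_apply]

theorem swap_braid (i : ℕ) :
    Equiv.swap i (i + 1) * (Equiv.swap (i + 1) (i + 1 + 1) * Equiv.swap i (i + 1)) =
      Equiv.swap (i + 1) (i + 1 + 1) * (Equiv.swap i (i + 1) *
        Equiv.swap (i + 1) (i + 1 + 1)) := by
  ext k
  simp only [Equiv.Perm.mul_apply, Equiv.swap_apply_def]
  split_ifs <;> omega

theorem swap_far_comm {i j : ℕ} (h : i + 1 < j) :
    Equiv.swap i (i + 1) * Equiv.swap j (j + 1) = Equiv.swap j (j + 1) * Equiv.swap i (i + 1) := by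
  ext k
  simp only [Equiv.Perm.mul_apply, Equiv.swap_apply_def]
  split_ifs <;> omega

/-! ### Products of generators along reduced words -/

section algebra

variable {F : Type*} [NontriviallyNormedField F] (t : F)

theorem wordProd_cons (i : ℕ) (w : List ℕ) : wordProd t (i :: w) = gen t i * wordProd t w := by
  simp [wordProd]

/-- Matsumoto's theorem for `H_∞`: the element `T_σ` is well defined. -/
theorem wordProd_eq_of_isReducedExpr (n : ℕ) : ∀ (w w' : List ℕ) (σ : Equiv.Perm ℕ),
    w.length = n → IsReducedExpr w σ → IsReducedExpr w' σ → wordProd t w = wordProd t w' := by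
  induction n with
  | zero =>
    intro w w' σ hn h h'
    have hl := h'.2 w h.1
    rw [List.length_eq_zero_iff.1 hn] at hl ⊢
    rw [List.length_eq_zero_iff.1 (Nat.le_zero.1 hl)]
  | succ n ih =>
    -- Two reduced words with different first letters `i`, `j` are compared through reduced words of
    -- `s_i σ` and `s_j σ` with a common ending, chosen so that a single commutation or braid
    -- relation joins the two sides.
    have main : ∀ (i j : ℕ) (u v : List ℕ) (σ : Equiv.Perm ℕ), i < j → u.length = n →
        v.length = n → IsReducedExpr (i :: u) σ → IsReducedExpr (j :: v) σ →
        wordProd t (i :: u) = wordProd t (j :: v) := by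
      intro i j u v σ hij hu hv h h'
      have di := h.descent
      have dj := h'.descent
      have pu : wordPerm u = Equiv.swap i (i + 1) * σ := h.tail.1
      rcases (Nat.succ_le_of_lt hij).lt_or_eq with hfar | rfl
      · simp only [Nat.succ_eq_add_one] at hfar
        -- Since `s_i` fixes `j` and `j + 1`, the descent `j` of `σ` persists in `s_i σ`. Hence `x`
        -- represents `s_j s_i σ`, and both `i j x` and `j i x` represent `σ`.
        obtain ⟨x, hx, px⟩ := exists_shorter_word u j (j + 1) (by omega) (by
          rw [pu, swap_mul_inv_apply, swap_mul_inv_apply,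
            Equiv.swap_apply_of_ne_of_ne (by omega) (by omega),
            Equiv.swap_apply_of_ne_of_ne (by omega) (by omega)]
          exact dj)
        have r1 : IsReducedExpr (j :: x) (Equiv.swap i (i + 1) * σ) :=
          h.tail.of_length_le (by rw [wordPerm_cons, px, Equiv.swap_mul_self_mul, pu])
            (by simpa using hx)
        have r2 : IsReducedExpr (i :: x) (Equiv.swap j (j + 1) * σ) :=
          h'.tail.of_length_le
            (by rw [wordPerm_cons, px, ← mul_assoc, swap_far_comm hfar, pu, mul_assoc,
              Equiv.swap_mul_self_mul])
            (by simp only [List.length_cons]; omega)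
        rw [wordProd_cons, wordProd_cons, ih _ _ _ hu h.tail r1, ih _ _ _ hv h'.tail r2,
          wordProd_cons, wordProd_cons, ← mul_assoc, ← mul_assoc, gen_comm t hfar]
      · simp only [Nat.succ_eq_add_one] at *
        -- Both descents together say that `σ⁻¹` is decreasing on `i, i + 1, i + 2`, so two
        -- successive exchanges are possible: `x` represents `s_{i+1} s_i σ` and `y` represents `s_i
        -- s_{i+1} s_i σ`.
        obtain ⟨x, hx, px⟩ := exists_shorter_word u (i + 1) (i + 1 + 1) (by omega) (by
          rw [pu, swap_mul_inv_apply, swap_mul_inv_apply, Equiv.swap_apply_right,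
            Equiv.swap_apply_of_ne_of_ne (by omega) (by omega)]
          exact dj.trans di)
        obtain ⟨y, hy, py⟩ := exists_shorter_word x i (i + 1) (by omega) (by
          rw [px, pu, swap_mul_inv_apply, swap_mul_inv_apply, swap_mul_inv_apply,
            swap_mul_inv_apply, Equiv.swap_apply_left,
            Equiv.swap_apply_of_ne_of_ne (by omega : i ≠ i + 1) (by omega),
            Equiv.swap_apply_left,
            Equiv.swap_apply_of_ne_of_ne (by omega : i + 1 + 1 ≠ i) (by omega)]
          exact dj)
        have r1 : IsReducedExpr ((i + 1) :: i :: y) (Equiv.swap i (i + 1) * σ) :=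
          h.tail.of_length_le (by rw [wordPerm_cons, wordPerm_cons, py, Equiv.swap_mul_self_mul,
            px, Equiv.swap_mul_self_mul, pu]) (by simp only [List.length_cons]; omega)
        have r2 : IsReducedExpr (i :: (i + 1) :: y) (Equiv.swap (i + 1) (i + 1 + 1) * σ) := by
          refine h'.tail.of_length_le ?_ (by simp only [List.length_cons]; omega)
          -- By the braid relation in the symmetric group, the same `y` also serves as the ending on
          -- the side starting with `i + 1`.
          have hb : wordPerm y = Equiv.swap (i + 1) (i + 1 + 1) * (Equiv.swap i (i + 1) *
              (Equiv.swap (i + 1) (i + 1 + 1) * σ)) := by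
            rw [py, px, pu]
            simpa only [mul_assoc] using congrArg (· * σ) (swap_braid i)
          rw [wordPerm_cons, wordPerm_cons, hb, Equiv.swap_mul_self_mul, Equiv.swap_mul_self_mul]
        rw [wordProd_cons, wordProd_cons, ih _ _ _ hu h.tail r1, ih _ _ _ hv h'.tail r2,
          wordProd_cons, wordProd_cons, wordProd_cons, wordProd_cons]
        simpa only [mul_assoc] using congrArg (· * wordProd t y) (gen_braid t i)
    intro w w' σ hn h h'
    have hn' : w'.length = n + 1 := le_antisymm (hn ▸ h'.2 w h.1) (hn ▸ h.2 w' h'.1)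
    match w, w', hn, hn' with
    | i :: u, j :: v, hn, hn' =>
      simp only [List.length_cons, Nat.add_right_cancel_iff] at hn hn'
      rcases lt_trichotomy i j with hij | rfl | hij
      · exact main i j u v σ hij hn hn' h h'
      · rw [wordProd_cons, wordProd_cons, ih u v _ hn h.tail h'.tail]
      · exact (main j i v u σ hij hn' hn h' h).symm

theorem iota_wordProd (w : List ℕ) : (iota t (wordProd t w)).unop = wordProd t w.reverse := by
  induction w with
  | nil => simp [wordProd]
  | cons i w ih =>
    rw [wordProd_cons, map_mul, MulOpposite.unop_mul, ih, iota_gen]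
    simp [wordProd]

end algebra

end HeckeTrace

end

noncomputable section

namespace HeckeTrace

/-! ### Finitely many tableaux with a given number of inversions -/

section inversions

variable {lam : YoungDiagram}

/-- Count the boxes `b` whose label in `τ` is below that of `a`; there are `τ(a)` of them. Each
either precedes `a` in the column-standard tableau or forms an inversion `(a, b)`. -/
theorem SYTInf.filling_le (τ : SYTInf lam) (a : InfBox lam) :
    τ.filling a ≤ (colStd lam).filling a + (Inv τ).card := by
  classical
  have hsub : (Finset.range (τ.filling a)).image (fun k => τ.filling.symm k) ⊆
      (Finset.range ((colStd lam).filling a)).image (fun k => (colStd lam).filling.symm k) ∪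
        (Inv τ).image Prod.snd := by
    intro b hb
    simp only [Finset.mem_image, Finset.mem_range] at hb
    obtain ⟨k, hk, rfl⟩ := hb
    set b := τ.filling.symm k with hbdef
    have hkb : τ.filling b = k := τ.filling.apply_symm_apply k
    rw [Finset.mem_union, Finset.mem_image, Finset.mem_image]
    rcases lt_trichotomy ((colStd lam).filling b) ((colStd lam).filling a) with h | h | h
    · exact Or.inl ⟨_, Finset.mem_range.2 h, Equiv.symm_apply_apply _ _⟩
    · rw [(colStd lam).filling.injective h] at hkb
      omega
    · exact Or.inr ⟨(a, b), mem_Inv.2 ⟨h, by simpa only [hkb] using hk⟩, rfl⟩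
  have hcard := Finset.card_le_card hsub
  rw [Finset.card_image_of_injective _ τ.filling.symm.injective, Finset.card_range] at hcard
  refine hcard.trans ((Finset.card_union_le _ _).trans (add_le_add ?_ Finset.card_image_le))
  exact Finset.card_image_le.trans_eq (Finset.card_range _)

/-- A standard tableau is determined by the labels outside of the infinite row. -/
theorem SYTInf.ext_of_lower {τ τ' : SYTInf lam}
    (h : ∀ b : InfBox lam, 0 < b.row → τ.filling b = τ'.filling b) : τ = τ' := by
  let top : ℕ → InfBox lam := fun c => ⟨0, c, Or.inl rfl⟩
  have hmono : ∀ ρ : SYTInf lam, StrictMono fun c => ρ.filling (top c) :=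
    fun ρ c d hcd => ρ.standard.1 (top c) (top d) rfl hcd
  have htop : ∀ b : InfBox lam, b.row = 0 → b = top b.col := fun b hb => InfBox.ext hb rfl
  -- The labels in the infinite row are exactly those not used below it, so tableaux which agree
  -- below have the same label set in that row.
  have hsub : ∀ ρ ρ' : SYTInf lam,
      (∀ b : InfBox lam, 0 < b.row → ρ.filling b = ρ'.filling b) →
      (Set.range fun c => ρ.filling (top c)) ⊆ Set.range fun c => ρ'.filling (top c) := by
    rintro ρ ρ' hρ _ ⟨c, rfl⟩
    obtain ⟨b, hb⟩ := ρ'.filling.surjective (ρ.filling (top c))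
    rcases Nat.eq_zero_or_pos b.row with h0 | h0
    · exact ⟨b.col, (congrArg ρ'.filling (htop b h0).symm).trans hb⟩
    · rw [← hρ b h0] at hb
      rw [ρ.filling.injective hb] at h0
      exact absurd h0 (lt_irrefl 0)
  have hrange := (hsub τ τ' h).antisymm (hsub τ' τ fun b hb => (h b hb).symm)
  -- The row is strictly increasing, and a strictly increasing sequence of naturals is determined by
  -- its range.
  have heq := ((hmono τ).range_inj (hmono τ')).1 hrange
  refine SYTInf.ext (Equiv.ext fun b => ?_)
  rcases Nat.eq_zero_or_pos b.row with h0 | h0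
  · rw [htop b h0]
    exact congrFun heq b.col
  · exact h b h0

/-- There are finitely many boxes below the infinite row, their labels are bounded by
`SYTInf.filling_le`, and they determine the tableau by `SYTInf.ext_of_lower`. -/
theorem finite_card_Inv_le (n : ℕ) : {τ : SYTInf lam | (Inv τ).card ≤ n}.Finite := by
  have := (finite_lower_boxes lam).to_subtype
  let f : SYTInf lam → ({b : InfBox lam | 0 < b.row} → ℕ) := fun τ b => τ.filling b.1
  refine Set.Finite.of_finite_image (f := f) ?_ ?_
  · refine (Set.Finite.pi' (t := fun b : {b : InfBox lam | 0 < b.row} =>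
      Set.Iic ((colStd lam).filling b.1 + n)) fun b => Set.finite_Iic _).subset ?_
    rintro _ ⟨τ, hτ, rfl⟩ b
    exact (τ.filling_le b.1).trans (Nat.add_le_add_left hτ _)
  · intro τ _ τ' _ h
    exact SYTInf.ext_of_lower fun b hb => congrFun h ⟨b, hb⟩

theorem tendsto_card_Inv :
    Tendsto (fun τ : SYTInf lam => (Inv τ).card) cofinite atTop := by
  refine tendsto_atTop.2 fun n => ?_
  filter_upwards [(finite_card_Inv_le (lam := lam) n).compl_mem_cofinite] with τ hτ
  exact le_of_not_ge hτ

end inversions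

/-! ### The invariance of the inner product -/

section adjoint

variable {F : Type*} [NontriviallyNormedField F] {lam : YoungDiagram} {t : F}

theorem form_comm (v w : SHat F lam) : form t v w = form t w v :=
  tsum_congr fun τ => by rw [mul_comm (v τ)]

/-- This is the symmetry of the off-diagonal part of `T_i` with respect to the weights `a(τ)`. Going
up, the coefficient is `1` and the identity is the recursion `normCoeff_swapTab`; going down is the
same identity read from `s_i(τ)`; for labels in one row or column both coefficients vanish. -/
theorem offCoeff_mul_normCoeff_swapTab (i : ℕ) (τ : SYTInf lam) :
    offCoeff t (contentDiff τ.filling i) * normCoeff t (swapTab i τ) =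
      offCoeff t (contentDiff (swapTab i τ).filling i) * normCoeff t τ := by
  have up : ∀ τ : SYTInf lam, 2 ≤ contentDiff τ.filling i →
      offCoeff t (contentDiff τ.filling i) * normCoeff t (swapTab i τ) =
        offCoeff t (contentDiff (swapTab i τ).filling i) * normCoeff t τ := by
    intro τ h
    rw [normCoeff_swapTab t τ i h, swapTab_coe (Or.inl h), contentDiff_swapLabels,
      offCoeff, if_pos h, offCoeff, if_neg (by omega), if_pos (by omega), neg_neg, one_mul]
  by_cases h : 2 ≤ contentDiff τ.filling i
  · exact up τ h
  · by_cases h' : 2 ≤ contentDiff (swapTab i τ).filling i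
    · have := up _ h'
      rw [swapTab_swapTab] at this
      exact this.symm
    · have h1 : ¬ contentDiff τ.filling i ≤ -2 := fun h2 => by
        rw [swapTab_coe (Or.inr h2), contentDiff_swapLabels] at h'
        omega
      have h2 : ¬ contentDiff (swapTab i τ).filling i ≤ -2 := fun h2 => by
        have h3 := swapTab_coe (Or.inr h2)
        rw [swapTab_swapTab] at h3
        rw [h3, contentDiff_swapLabels] at h
        omega
      rw [offCoeff_eq_zero t (by omega), offCoeff_eq_zero t (by omega), zero_mul, zero_mul]

/-- Induction on the free algebra, pushed through the quotient map; it reduces the adjoint formula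
to the generators. -/
theorem hecke_induction {p : InfHecke t → Prop} (algebraMap : ∀ a, p (algebraMap F _ a))
    (gen : ∀ i, p (gen t i)) (mul : ∀ X Y, p X → p Y → p (X * Y))
    (add : ∀ X Y, p X → p Y → p (X + Y)) (X : InfHecke t) : p X := by
  obtain ⟨x, rfl⟩ := RingQuot.mkAlgHom_surjective F (HeckeRel t) X
  induction x using FreeAlgebra.induction with
  | grade0 a => simpa using algebraMap a
  | grade1 i => exact gen i
  | mul x y hx hy => simpa using mul _ _ hx hy
  | add x y hx hy => simpa using add _ _ hx hy

theorem form_smul_left (a : F) (v w : SHat F lam) : form t (a • v) w = a * form t v w := by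
  unfold form
  rw [← tsum_mul_left]
  refine tsum_congr fun τ => ?_
  rw [ZeroAtInftyContinuousMap.smul_apply, smul_eq_mul]
  ring

variable [IsUltrametricDist F] [CompleteSpace F]

theorem form_add_left (ht : IsPseudoUniformizer t) (v v' w : SHat F lam) :
    form t (v + v') w = form t v w + form t v' w := by
  unfold form
  rw [← (form_summable ht v w).tsum_add (form_summable ht v' w)]
  refine tsum_congr fun τ => ?_
  rw [ZeroAtInftyContinuousMap.add_apply]
  ring

/-- The operators `T_i` are self-adjoint. -/
theorem form_genOp (ht : IsPseudoUniformizer t) (i : ℕ) (v w : SHat F lam) :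
    form t (genOp ht lam i v) w = form t v (genOp ht lam i w) := by
  let e : SYTInf lam ≃ SYTInf lam :=
    Function.Involutive.toPerm (swapTab i) (swapTab_swapTab i)
  -- The summand of the form is split into a diagonal part `A`, symmetric in `v` and `w`, and a part
  -- `B` linking `τ` with `s_i(τ)`. The two are summed separately so that `B` alone can be reindexed
  -- by the involution `s_i`.
  let A : SYTInf lam → F := fun τ =>
    diagCoeff t (contentDiff τ.filling i) * (v τ * w τ * normCoeff t τ)
  let B : SYTInf lam → F := fun τ =>
    offCoeff t (contentDiff (swapTab i τ).filling i) * v (swapTab i τ) * w τ * normCoeff t τ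
  have hA : Summable A := by
    apply NonarchimedeanAddGroup.summable_of_tendsto_cofinite_zero
    refine squeeze_zero_norm (fun τ => ?_)
      (tendsto_zero_iff_norm_tendsto_zero.1 (form_summable ht v w).tendsto_cofinite_zero)
    rw [norm_mul]
    exact mul_le_of_le_one_left (norm_nonneg _) (norm_diagCoeff_le ht _)
  have hAB : Summable fun τ => A τ + B τ := by
    refine (form_summable ht (genOp ht lam i v) w).congr fun τ => ?_
    simp only [A, B, genOp_apply, genFun]
    ring
  have hB : Summable B := by simpa using hAB.sub hA
  calc form t (genOp ht lam i v) w = ∑' τ, (A τ + B τ) := tsum_congr fun τ => by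
        simp only [A, B, genOp_apply, genFun]
        ring
    _ = ∑' τ, A τ + ∑' τ, B τ := hA.tsum_add hB
    _ = ∑' τ, A τ + ∑' τ, B (e τ) := by rw [e.tsum_eq]
    _ = ∑' τ, (A τ + B (e τ)) := (hA.tsum_add (e.summable_iff.2 hB)).symm
    _ = form t v (genOp ht lam i w) := tsum_congr fun τ => by
        have h := offCoeff_mul_normCoeff_swapTab (t := t) i τ
        have he : e τ = swapTab i τ := rfl
        simp only [A, B, genOp_apply, genFun, he, swapTab_swapTab]
        linear_combination v τ * w (swapTab i τ) * h

/-- The adjoint of `X` is `ι(X)`. -/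
theorem form_rep (ht : IsPseudoUniformizer t) (X : InfHecke t) : ∀ v w : SHat F lam,
    form t (rep lam ht X v) w = form t v (rep lam ht (iota t X).unop w) := by
  induction X using hecke_induction with
  | algebraMap a =>
    intro v w
    simp only [AlgEquiv.commutes, MulOpposite.algebraMap_apply, MulOpposite.unop_op,
      AlgHom.commutes, ContinuousLinearMap.algebraMap_apply]
    exact (form_smul_left a v w).trans
      (by rw [form_comm v (a • w), form_smul_left, form_comm])
  | gen i =>
    intro v w
    rw [iota_gen, MulOpposite.unop_op, rep_gen]
    exact form_genOp ht i v w
  | mul X Y hX hY =>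
    intro v w
    simp only [map_mul, MulOpposite.unop_mul]
    -- First `X` and then `Y` moves to the right, giving `ι(Y) ι(X) = ι(X Y)`.
    exact (hX _ w).trans (hY v _)
  | add X Y hX hY =>
    intro v w
    simp only [map_add, MulOpposite.unop_add, _root_.add_apply]
    rw [form_add_left ht, form_comm v, form_add_left ht, hX, hY, form_comm v, form_comm v]

theorem traceTerm_iota (ht : IsPseudoUniformizer t) (X : InfHecke t) (τ : SYTInf lam) :
    traceTerm ht lam (iota t X).unop τ = traceTerm ht lam X τ := by
  unfold traceTerm
  rw [form_rep ht X, form_comm]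

end adjoint

/-! ### Convergence of the regularized trace -/

section convergence

variable {F : Type*} [NontriviallyNormedField F] {lam : YoungDiagram} {t : F}

theorem form_smul_basisVec (v : SHat F lam) (a : F) (τ : SYTInf lam) :
    form t v (a • basisVec F τ) = v τ * a * normCoeff t τ := by
  classical
  have happly : ∀ σ, (a • basisVec F τ : SHat F lam) σ = if σ = τ then a else 0 := by
    intro σ
    change a * (Pi.single τ (1 : F) : SYTInf lam → F) σ = _
    rw [Pi.single_apply]
    simp
  unfold form
  rw [tsum_eq_single τ]
  · rw [happly, if_pos rfl]
  · intro σ hσ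
    rw [happly, if_neg hσ, mul_zero, zero_mul]

variable [IsUltrametricDist F]

/-- On an inversion pair the content difference is at least `2`, so numerators and denominators are
of the form `1 - t^k` with `k ≥ 1` and have norm `1`. Renormalizing therefore does not affect the
size of the terms. -/
theorem norm_renormVec_coeff (ht : IsPseudoUniformizer t) (τ : SYTInf lam) :
    ‖∏ p ∈ Inv τ, (1 - t ^ (p.2.content - p.1.content)) /
      (1 - t ^ (p.2.content - p.1.content + 1))‖ = 1 := by
  rw [norm_prod]
  refine Finset.prod_eq_one fun p hp => ?_
  have h : 2 ≤ p.2.content - p.1.content := invSet_content (mem_Inv.1 hp)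
  rw [norm_div, norm_one_sub_zpow ht (by omega), norm_one_sub_zpow ht (by omega), div_one]

theorem norm_renormVec_le (ht : IsPseudoUniformizer t) (τ : SYTInf lam) :
    ‖(renormVec t τ : SHat F lam)‖ ≤ 1 := by
  classical
  unfold renormVec
  rw [norm_smul, norm_renormVec_coeff ht, one_mul, ← ZeroAtInftyContinuousMap.norm_toBCF_eq_norm,
    BoundedContinuousFunction.norm_le zero_le_one]
  intro σ
  change ‖basisVec F τ σ‖ ≤ 1
  rw [basisVec_apply]
  split_ifs <;> simp

/-- The form against a multiple of `e_τ` sees only the coefficient at `τ`. That coefficient of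
`Xẽ_τ` is at most `‖X‖`, the renormalizing factor has norm `1`, and `a(τ)` contributes the power of
`‖t‖`. -/
theorem norm_traceTerm_le (ht : IsPseudoUniformizer t) (X : InfHecke t) (τ : SYTInf lam) :
    ‖traceTerm ht lam X τ‖ ≤ ‖rep lam ht X‖ * ‖t‖ ^ (Inv τ).card := by
  have hX : ‖rep lam ht X (renormVec t τ) τ‖ ≤ ‖rep lam ht X‖ :=
    (norm_apply_le _ τ).trans (((rep lam ht X).le_opNorm _).trans
      (mul_le_of_le_one_right (norm_nonneg _) (norm_renormVec_le ht τ)))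
  have hterm : traceTerm ht lam X τ = rep lam ht X (renormVec t τ) τ *
      (∏ p ∈ Inv τ, (1 - t ^ (p.2.content - p.1.content)) /
        (1 - t ^ (p.2.content - p.1.content + 1))) * normCoeff t τ :=
    form_smul_basisVec _ _ _
  rw [hterm, norm_mul, norm_mul, norm_renormVec_coeff ht, mul_one, norm_normCoeff ht]
  exact mul_le_mul_of_nonneg_right hX (by positivity)

/-- The inversion number tends to infinity along the cofinite filter, so the bound on the terms
tends to `0`; over a complete non-archimedean field this is enough for summability. -/
theorem summable_traceTerm [CompleteSpace F] (ht : IsPseudoUniformizer t) (X : InfHecke t) :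
    Summable (traceTerm ht lam X) := by
  apply NonarchimedeanAddGroup.summable_of_tendsto_cofinite_zero
  refine squeeze_zero_norm (norm_traceTerm_le ht X) ?_
  simpa using ((tendsto_pow_atTop_nhds_zero_of_lt_one (norm_nonneg t) ht.2).comp
    tendsto_card_Inv).const_mul ‖rep lam ht X‖

theorem regTrace_iota [CompleteSpace F] (ht : IsPseudoUniformizer t) (X : InfHecke t) :
    regTrace ht lam (iota t X).unop = regTrace ht lam X :=
  tsum_congr (traceTerm_iota ht X)

end convergence

end HeckeTrace

end

/-! ### Convergence and invariance of the regularized trace -/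

theorem mainTheorem6 {F : Type*} [NontriviallyNormedField F] [IsUltrametricDist F]
    [CompleteSpace F] (t : F) (ht : HeckeTrace.IsPseudoUniformizer t) (lam : YoungDiagram) :
    (∀ X : HeckeTrace.InfHecke t, Summable (HeckeTrace.traceTerm ht lam X)) ∧
    (∀ X : HeckeTrace.InfHecke t,
      HeckeTrace.regTrace ht lam (HeckeTrace.iota t X).unop = HeckeTrace.regTrace ht lam X) ∧
    (∀ σ : Equiv.Perm ℕ, {k | σ k ≠ k}.Finite →
      ∀ w w' : List ℕ, HeckeTrace.IsReducedExpr w σ → HeckeTrace.IsReducedExpr w' σ⁻¹ →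
        HeckeTrace.regTrace ht lam (HeckeTrace.wordProd t w) =
          HeckeTrace.regTrace ht lam (HeckeTrace.wordProd t w')) := by
  refine ⟨HeckeTrace.summable_traceTerm ht, HeckeTrace.regTrace_iota ht, ?_⟩
  intro σ _ w w' hw hw'
  -- Applying `ι` replaces `w` by its reversal, a reduced expression of `σ⁻¹`; Matsumoto's theorem
  -- then identifies its product with that of `w'`.
  rw [← HeckeTrace.regTrace_iota ht (HeckeTrace.wordProd t w), HeckeTrace.iota_wordProd,
    HeckeTrace.wordProd_eq_of_isReducedExpr t _ _ _ _ rfl hw.reverse hw']
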